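/- Let $\kappa\ge 1$, let $\Sigma_\kappa=\{1,\dots,\kappa\}^{\mathbb Z}$ carry the product topology and let $\sigma$ be the left shift. Let $A:\Sigma_\kappa\to SL(3,\mathbb R)$ be a cocycle that is locally constant on cylinders of size one ($A(\omega)$ depends only on $\omega_0$), with $A^{(n)}(\omega)=A(\sigma^{n-1}\omega)\cdots A(\omega)$ and $A^{(-n)}(\omega)=(A^{(n)}(\sigma^{-n}\omega))^{-1}$ for $n\ge 1$, $A^{(0)}=I$. Assume that $A$ admits a finest one-dimensional dominated splitting: a continuous $A$-invariant splitting $\Sigma_\kappa\times\mathbb R^3=E^1\oplus E^2\oplus E^3$ into line bundles and, for $i=1,2$, constants $C>0$, $\theta\in(0,1)$ with $\|A^{(n)}(\omega)|_{E^{i+1}_\omega}\|\,\|(A^{(n)}(\omega)|_{E^i_\omega})^{-1}\|\le C\theta^n$ for all $\omega$ and $n\ge 1$. (In particular, $A$ may be any such uniformly hyperbolic cocycle with two-dimensional stable bundle.) A point $\omega$ is Lyapunov typical if there are a splitting $\mathbb R^3=F^1\oplus\dots\oplus F^k$ into non-zero subspaces and numbers $\lambda_1>\dots>\lambda_k$ such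 that $\frac1n\log\|A^{(n)}(\omega)v\|\to\lambda_i$ as $n\to+\infty$ and as $n\to-\infty$, for all $v\in F^i\setminus\{0\}$; otherwise it is Lyapunov non-typical. It is forward irregular if for some $v\ne0$ the limit of $\frac1n\log\|A^{(n)}(\omega)v\|$ as $n\to+\infty$ does not exist. The Lyapunov spectrum at $\omega$ is the set of all existing limits $\lim_{n\to+\infty}\frac1n\log\|A^{(n)}(\omega)v\|$, $v\neq 0$; it is simple if it has three elements. Cocycles $A,B$ are cohomologous if $A(\omega)=C(\sigma\omega)B(\omega)C(\omega)^{-1}$ for all $\omega$ and some map $C:\Sigma_\kappa\to SL(3,\mathbb R)$, and continuously cohomologous if $C$ can be chosen continuous. A cocycle $B$ with values in $SL(3,\mathbb R)$ is constant up to signs if $B(\omega)=\mathrm{diag}(\pm\mu_1,\pm\mu_2,\pm\mu_3)$ with distinct constants $\mu_i>0$, where only the signs may depend on $\omega$. Finally, $A$ has constant orientation if for each $i$ there are a continuous nowhere zero section $v_i$ of $E^i$ and a sign $s_i\in\{1,-1\}$ such that $A(\omega)v_i(\omega)$ is a positive multiple of $s_iv_i(\sigma\omega)$ for every $\omega$.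 (a) The following are equivalent: (1) the set of Lyapunov non-typical points of $A$ is empty; (1') the set of forward irregular points of $A$ is empty; (2) all periodic points of $\sigma$ have the same Lyapunov spectrum; (3) $A$ is continuously cohomologous to a cocycle that is constant up to signs; (3') $A$ is cohomologous to a cocycle that is constant up to signs. (b) The following are equivalent: $A$ has constant orientation and its set of Lyapunov non-typical points is empty; $A$ is continuously cohomologous to a constant cocycle with simple Lyapunov spectrum; $A$ is cohomologous to a constant cocycle with simple Lyapunov spectrum. In particular, if $A$ has constant orientation, then (1), (2) and "$A$ is cohomologous to a constant cocycle with simple Lyapunov spectrum" are equivalent. (c) If the set of Lyapunov non-typical points is non-empty (that is, if any of the properties in (a) fails), then the set of forward irregular points, and hence the set of Lyapunov non-typical points, is Baire generic (residual) in $\Sigma_\kappa$. -/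

import Mathlib

open Filter Topology

/-- The two-sided full shift space on `κ` symbols, with the product topology. -/
abbrev FullShift (κ : ℕ) : Type := ℤ → Fin κ

namespace FullShift

/-- The `n`-th power (`n ∈ ℤ`) of the left shift. -/
def shiftBy {κ : ℕ} (n : ℤ) (ω : FullShift κ) : FullShift κ := fun i => ω (i + n)

/-- The left shift `σ`. -/
def shift {κ : ℕ} (ω : FullShift κ) : FullShift κ := shiftBy 1 ω

end FullShift

open FullShift

/-- A linear cocycle over the full shift with values in `SL(d, ℝ)`. -/
abbrev LinCocycle (κ d : ℕ) : Type :=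
  FullShift κ → Matrix.SpecialLinearGroup (Fin d) ℝ

/-- The linear action of `SL(d, ℝ)` on Euclidean space `ℝ^d`. -/
noncomputable def slAct {d : ℕ} (M : Matrix.SpecialLinearGroup (Fin d) ℝ) :
    EuclideanSpace ℝ (Fin d) →ₗ[ℝ] EuclideanSpace ℝ (Fin d) :=
  Matrix.toEuclideanLin (M : Matrix (Fin d) (Fin d) ℝ)

namespace LinCocycle

variable {κ d : ℕ}

/-- `A` is locally constant on cylinders of size one: `A(ω)` depends only on `ω₀`. -/
def IsLocConst (A : LinCocycle κ d) : Prop :=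
  ∀ ω ω' : FullShift κ, ω 0 = ω' 0 → A ω = A ω'

/-- `A^{(n)}(ω) = A(σ^{n-1} ω) ⋯ A(σ ω) A(ω)` for natural `n`. -/
def iterNat (A : LinCocycle κ d) : ℕ → LinCocycle κ d
  | 0, _ => 1
  | n + 1, ω => A (shiftBy (n : ℤ) ω) * iterNat A n ω

/-- `A^{(n)}(ω)` for integers `n`, with `A^{(-n)}(ω) = (A^{(n)}(σ^{-n} ω))⁻¹`. -/
def iter (A : LinCocycle κ d) : ℤ → LinCocycle κ d
  | Int.ofNat n, ω => iterNat A n ω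
  | Int.negSucc n, ω => (iterNat A (n + 1) (shiftBy (Int.negSucc n) ω))⁻¹

/-- The finite-time exponent `(1/n) log ‖A^{(n)}(ω) v‖`, `n ∈ ℤ`. -/
noncomputable def finiteExponent (A : LinCocycle κ d) (ω : FullShift κ)
    (v : EuclideanSpace ℝ (Fin d)) (n : ℤ) : ℝ :=
  (1 / (n : ℝ)) * Real.log ‖slAct (iter A n ω) v‖

/-- `ω` is Lyapunov typical: there are a splitting `ℝ^d = E¹ ⊕ ⋯ ⊕ E^k` into non-zero subspaces
and numbers `l₁ > ⋯ > l_k` such that `(1/n) log ‖A^{(n)}(ω) v‖ → l_i` both as `n → +∞` and as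
`n → -∞`, for every non-zero `v ∈ E^i`. -/
def IsLyapunovTypical (A : LinCocycle κ d) (ω : FullShift κ) : Prop :=
  ∃ (k : ℕ) (E : Fin k → Submodule ℝ (EuclideanSpace ℝ (Fin d))) (l : Fin k → ℝ),
    DirectSum.IsInternal E ∧ (∀ i, E i ≠ ⊥) ∧ StrictAnti l ∧
    ∀ i, ∀ v ∈ E i, v ≠ 0 →
      Tendsto (finiteExponent A ω v) atTop (𝓝 (l i)) ∧
      Tendsto (finiteExponent A ω v) atBot (𝓝 (l i))

/-- The set of Lyapunov non-typical points. -/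
def nonTypical (A : LinCocycle κ d) : Set (FullShift κ) :=
  {ω | ¬ IsLyapunovTypical A ω}

/-- The set of points at which, along some direction `v`, the Lyapunov exponent is not well defined
under forward iteration. -/
def forwardIrregular (A : LinCocycle κ d) : Set (FullShift κ) :=
  {ω | ∃ v : EuclideanSpace ℝ (Fin d), v ≠ 0 ∧
    ¬ ∃ l : ℝ, Tendsto (finiteExponent A ω v) atTop (𝓝 l)}

/-- The Lyapunov spectrum at `ω`: the set of all Lyapunov exponents
`lim (1/n) log ‖A^{(n)}(ω) v‖`, `v ≠ 0`. -/
def lyapunovSpectrum (A : LinCocycle κ d) (ω : FullShift κ) : Set ℝ :=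
  {l | ∃ v : EuclideanSpace ℝ (Fin d), v ≠ 0 ∧ Tendsto (finiteExponent A ω v) atTop (𝓝 l)}

/-- The spectrum is simple: there are `d` distinct exponents, the maximal possible number. -/
def HasSimpleSpectrum (A : LinCocycle κ d) : Prop :=
  ∀ ω, (lyapunovSpectrum A ω).ncard = d

/-- All periodic points of the shift have the same Lyapunov spectrum. -/
def PeriodicSpectraAgree (A : LinCocycle κ d) : Prop :=
  ∀ ω ∈ Function.periodicPts (shift (κ := κ)), ∀ ω' ∈ Function.periodicPts (shift (κ := κ)),
    lyapunovSpectrum A ω = lyapunovSpectrum A ω'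

/-- The bundle `E` dominates the bundle `F`:
`‖A^{(n)}(ω)|_F‖ ⬝ ‖(A^{(n)}(ω)|_E)⁻¹‖ ≤ C θⁿ`, written out on vectors. -/
def Dominates (A : LinCocycle κ d)
    (E F : FullShift κ → Submodule ℝ (EuclideanSpace ℝ (Fin d))) : Prop :=
  ∃ C θ : ℝ, 0 < C ∧ 0 < θ ∧ θ < 1 ∧ ∀ n : ℕ, 1 ≤ n → ∀ ω, ∀ v ∈ E ω, ∀ w ∈ F ω,
    ‖slAct (iterNat A n ω) w‖ * ‖v‖ ≤ C * θ ^ n * (‖slAct (iterNat A n ω) v‖ * ‖w‖)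

/-- `E⁰ ⊕ ⋯ ⊕ E^{d-1}` is a finest dominated splitting into one-dimensional subbundles:
a continuous `A`-invariant splitting into lines, each dominating the next one.
Continuity of a subbundle is continuity of the orthogonal projection onto it. -/
structure IsFinestDominatedSplitting (A : LinCocycle κ d)
    (E : Fin d → FullShift κ → Submodule ℝ (EuclideanSpace ℝ (Fin d))) : Prop where
  one_dim : ∀ i ω, Module.finrank ℝ (E i ω) = 1
  splits : ∀ ω, DirectSum.IsInternal (fun i => E i ω)
  continuous : ∀ i, Continuous fun ω => (E i ω).starProjection
  invariant : ∀ i ω, (E i ω).map (slAct (A ω)) = E i (shift ω)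
  dominated : ∀ i j : Fin d, (i : ℕ) + 1 = j → Dominates A (E i) (E j)

/-- `A` acts on each line bundle `E^i` with a constant orientation character: there are a
continuous nowhere zero section `v_i` of `E^i` and a sign `s_i = ±1` such that
`A(ω) v_i(ω)` is a positive multiple of `s_i v_i(σ ω)` for all `ω`. -/
def HasConstantOrientation (A : LinCocycle κ d)
    (E : Fin d → FullShift κ → Submodule ℝ (EuclideanSpace ℝ (Fin d))) : Prop :=
  ∀ i, ∃ (v : FullShift κ → EuclideanSpace ℝ (Fin d)) (s : ℝ),
    Continuous v ∧ (∀ ω, v ω ∈ E i ω ∧ v ω ≠ 0) ∧ (s = 1 ∨ s = -1) ∧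
    ∀ ω, ∃ a : ℝ, 0 < a ∧ slAct (A ω) (v ω) = (s * a) • v (shift ω)

/-- `A(ω) = C(σ ω) B(ω) C(ω)⁻¹` for some `C : Σ → SL(d, ℝ)`, of no particular regularity. -/
def Cohomologous (A B : LinCocycle κ d) : Prop :=
  ∃ C : LinCocycle κ d, ∀ ω, A ω = C (shift ω) * B ω * (C ω)⁻¹

/-- `A(ω) = C(σ ω) B(ω) C(ω)⁻¹` for some continuous `C : Σ → SL(d, ℝ)`. -/
def ContCohomologous (A B : LinCocycle κ d) : Prop :=
  ∃ C : LinCocycle κ d, Continuous C ∧ ∀ ω, A ω = C (shift ω) * B ω * (C ω)⁻¹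

/-- `B` is diagonal with entries `±μ_i`, where `μ_1, …, μ_d > 0` are distinct constants and only the
signs may depend on `ω`. -/
def IsConstUpToSigns (B : LinCocycle κ d) : Prop :=
  ∃ μ : Fin d → ℝ, (∀ i, 0 < μ i) ∧ Function.Injective μ ∧
    ∀ ω i j, |(B ω : Matrix (Fin d) (Fin d) ℝ) i j| = Matrix.diagonal μ i j

end LinCocycle

/-! Since the full shift is zero-dimensional, each line bundle has a continuous nowhere zero
section. These sections form a continuous frame `C` of determinant one in which `A` becomes a
diagonal cocycle `D`. Exponents are unchanged by this conjugacy, because `C` is bounded, so they are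
limits of Birkhoff means of `log |D ω i i|`.

The main step is to show that periodic data determine `D` up to coboundary. Fix a constant sequence
`z`. By local constancy, the dominating line depends only on the past and the sum of the dominated
lines only on the future. Splicing a past to a future shows that the dominating line at one point is
transverse to the dominated sum at any other, so `g ω = ((C z)⁻¹ * C ω) i₀ i₀` never vanishes.
Closing up a finite word by long blocks of `z` on both sides gives periodic points whose multipliers
determine the leading entry of the word's matrix in the frame of `z` (`map_homoclinic_entry`).
Comparing consecutive words then shows, first on the dense set of sequences with past `z`, that `g`
solves the cohomological equation (`exists_scaling_of_dominating`). Time reversal turns the weakest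
line into the dominating one, and the determinant condition settles the middle line
(`exists_rescaled_frame`).

The argument runs through a continuous multiplicative map `χ` on the reals. The absolute value gives
the statements up to signs, the identity those with constant orientation.

If two periodic points have different spectra, some `log |D ω i i|` has different means along their
orbits. Either tail can be spliced onto any finite word, so the Birkhoff means of a generic point
come close to both values infinitely often and diverge (`residual_forwardIrregular`). An arbitrary
conjugacy is bounded on a periodic orbit, which is why cohomology without regularity already fixes
the periodic data. -/

namespace FullShift

/-! ### Shifts, splicing and uniform continuity on the full shift -/

variable {κ : ℕ}

@[simp] theorem shiftBy_apply (n : ℤ) (ω : FullShift κ) (i : ℤ) : shiftBy n ω i = ω (i + n) := rfl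

@[simp] theorem shiftBy_zero (ω : FullShift κ) : shiftBy 0 ω = ω := by
  funext i; simp

theorem shiftBy_shiftBy (m n : ℤ) (ω : FullShift κ) :
    shiftBy m (shiftBy n ω) = shiftBy (m + n) ω := by
  funext i; simp [add_assoc]

theorem shift_shiftBy (n : ℤ) (ω : FullShift κ) : shift (shiftBy n ω) = shiftBy (n + 1) ω := by
  rw [shift, shiftBy_shiftBy, add_comm]

theorem shiftBy_shift (n : ℤ) (ω : FullShift κ) : shiftBy n (shift ω) = shiftBy (n + 1) ω := by
  rw [shift, shiftBy_shiftBy]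

theorem continuous_shiftBy (n : ℤ) : Continuous (shiftBy n : FullShift κ → FullShift κ) :=
  continuous_pi fun i => continuous_apply (i + n)

theorem continuous_shift : Continuous (shift : FullShift κ → FullShift κ) := continuous_shiftBy 1

theorem shift_iterate (n : ℕ) (ω : FullShift κ) : shift^[n] ω = shiftBy n ω := by
  induction n with
  | zero => simp
  | succ n ih => rw [Function.iterate_succ_apply', ih, shift_shiftBy]; push_cast; rfl

theorem mem_periodicPts_iff (p : FullShift κ) :
    p ∈ Function.periodicPts (shift (κ := κ)) ↔ ∃ N : ℕ, 0 < N ∧ shiftBy N p = p := by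
  simp only [Function.mem_periodicPts, Function.IsPeriodicPt, Function.IsFixedPt, shift_iterate]

/-- The sequence equal to `ω` to the left of `m` and to `ω'` from `m` on. -/
def splice (m : ℤ) (ω ω' : FullShift κ) : FullShift κ := fun j => if j < m then ω j else ω' j

theorem splice_of_lt {m j : ℤ} (ω ω' : FullShift κ) (h : j < m) : splice m ω ω' j = ω j :=
  if_pos h

theorem splice_of_le {m j : ℤ} (ω ω' : FullShift κ) (h : m ≤ j) : splice m ω ω' j = ω' j :=
  if_neg (not_lt.mpr h)

theorem tendsto_of_eventually_eq {ι : Type*} {l : Filter ι} {x : ι → FullShift κ} {ω : FullShift κ}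
    (h : ∀ j, ∀ᶠ n in l, x n j = ω j) : Tendsto x l (𝓝 ω) :=
  tendsto_pi_nhds.mpr fun j =>
    tendsto_const_nhds.congr' ((h j).mono fun _ hn => hn.symm)

theorem tendsto_splice_right (ω ω' : FullShift κ) :
    Tendsto (fun n : ℕ => splice n ω ω') atTop (𝓝 ω) := by
  refine tendsto_of_eventually_eq fun j => ?_
  filter_upwards [eventually_gt_atTop j.toNat] with n hn
  exact splice_of_lt _ _ (by omega)

theorem tendsto_splice_left (ω ω' : FullShift κ) :
    Tendsto (fun n : ℕ => splice (-n) ω' ω) atTop (𝓝 ω) := by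
  refine tendsto_of_eventually_eq fun j => ?_
  filter_upwards [eventually_gt_atTop (-j).toNat] with n hn
  exact splice_of_le _ _ (by omega)

/-- Uniform continuity on the full shift: the value of a continuous function is determined up to
`ε` by finitely many symbols. -/
theorem exists_window {X : Type*} [MetricSpace X] {f : FullShift κ → X} (hf : Continuous f)
    {ε : ℝ} (hε : 0 < ε) :
    ∃ m : ℕ, ∀ ω ω' : FullShift κ, (∀ j : ℤ, |j| ≤ m → ω j = ω' j) → dist (f ω) (f ω') < ε := by
  by_contra! hcon
  -- Counterexamples for window `m` form decreasing nonempty compact sets. A common point lies on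
  -- the diagonal, where the distance is zero.
  let t : ℕ → Set (FullShift κ × FullShift κ) := fun m =>
    {x | ∀ j : ℤ, |j| ≤ m → x.1 j = x.2 j} ∩ {x | ε ≤ dist (f x.1) (f x.2)}
  have hclosed : ∀ m, IsClosed (t m) := by
    intro m
    refine IsClosed.inter ?_ ?_
    · have : {x : FullShift κ × FullShift κ | ∀ j : ℤ, |j| ≤ m → x.1 j = x.2 j} =
          ⋂ j : ℤ, ⋂ _ : |j| ≤ m, {x | x.1 j = x.2 j} := by
        ext x; simp
      rw [this]
      refine isClosed_iInter fun j => isClosed_iInter fun _ => isClosed_eq ?_ ?_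
      · exact (continuous_apply j).comp continuous_fst
      · exact (continuous_apply j).comp continuous_snd
    · exact isClosed_le continuous_const
        ((hf.comp continuous_fst).dist (hf.comp continuous_snd))
  have hanti : Antitone t := fun m n hmn x hx =>
    ⟨fun j hj => hx.1 j (hj.trans (by exact_mod_cast hmn)), hx.2⟩
  obtain ⟨x, hx⟩ := IsCompact.nonempty_iInter_of_directed_nonempty_isCompact_isClosed t
    hanti.directed_ge (fun m => by
      obtain ⟨ω, ω', h1, h2⟩ := hcon m
      exact ⟨(ω, ω'), h1, h2⟩) (fun m => (hclosed m).isCompact) hclosed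
  rw [Set.mem_iInter] at hx
  have heq : x.1 = x.2 := by
    funext j
    exact (hx j.natAbs).1 j (by simp)
  have : ε ≤ dist (f x.1) (f x.2) := (hx 0).2
  rw [heq, dist_self] at this
  exact absurd this (not_le.mpr hε)

end FullShift

/-! ### The action of `SL(d, ℝ)` and its operator norm -/

section SlAct

variable {d : ℕ}

theorem slAct_apply (M : Matrix.SpecialLinearGroup (Fin d) ℝ) (v : EuclideanSpace ℝ (Fin d))
    (i : Fin d) : slAct M v i = ∑ j, M i j * v j := rfl

theorem slAct_mul (M N : Matrix.SpecialLinearGroup (Fin d) ℝ) (v : EuclideanSpace ℝ (Fin d)) :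
    slAct (M * N) v = slAct M (slAct N v) := by
  ext i
  simp only [slAct_apply, Matrix.SpecialLinearGroup.coe_mul, Matrix.mul_apply, Finset.sum_mul,
    Finset.mul_sum]
  rw [Finset.sum_comm]
  simp only [mul_assoc]

theorem slAct_one (v : EuclideanSpace ℝ (Fin d)) : slAct 1 v = v := by
  ext i
  simp [slAct_apply, Matrix.one_apply]

theorem slAct_inv_slAct (M : Matrix.SpecialLinearGroup (Fin d) ℝ) (v : EuclideanSpace ℝ (Fin d)) :
    slAct M⁻¹ (slAct M v) = v := by
  rw [← slAct_mul, inv_mul_cancel, slAct_one]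

theorem slAct_slAct_inv (M : Matrix.SpecialLinearGroup (Fin d) ℝ) (v : EuclideanSpace ℝ (Fin d)) :
    slAct M (slAct M⁻¹ v) = v := by
  rw [← slAct_mul, mul_inv_cancel, slAct_one]

theorem slAct_ne_zero (M : Matrix.SpecialLinearGroup (Fin d) ℝ) {v : EuclideanSpace ℝ (Fin d)}
    (hv : v ≠ 0) : slAct M v ≠ 0 := fun h => hv (by rw [← slAct_inv_slAct M v, h, map_zero])

theorem slAct_single (M : Matrix.SpecialLinearGroup (Fin d) ℝ) (i j : Fin d) :
    slAct M (EuclideanSpace.single i 1) j = M j i := by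
  simp [slAct_apply]

/-- The operator norm of the action on Euclidean space. -/
noncomputable def slNorm (M : Matrix.SpecialLinearGroup (Fin d) ℝ) : ℝ :=
  ‖Matrix.toEuclideanCLM (n := Fin d) (𝕜 := ℝ) (M : Matrix (Fin d) (Fin d) ℝ)‖

theorem norm_slAct_le (M : Matrix.SpecialLinearGroup (Fin d) ℝ) (v : EuclideanSpace ℝ (Fin d)) :
    ‖slAct M v‖ ≤ slNorm M * ‖v‖ :=
  (Matrix.toEuclideanCLM (n := Fin d) (𝕜 := ℝ) (M : Matrix (Fin d) (Fin d) ℝ)).le_opNorm v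

theorem continuous_slNorm :
    Continuous (slNorm : Matrix.SpecialLinearGroup (Fin d) ℝ → ℝ) := by
  have h : Continuous fun M : Matrix (Fin d) (Fin d) ℝ =>
      Matrix.toEuclideanCLM (n := Fin d) (𝕜 := ℝ) M :=
    LinearMap.continuous_of_finiteDimensional
      ((Matrix.toEuclideanCLM (n := Fin d) (𝕜 := ℝ)).toAlgEquiv.toLinearMap)
  exact (h.comp continuous_subtype_val).norm

theorem norm_le_slNorm_inv (M : Matrix.SpecialLinearGroup (Fin d) ℝ)
    (v : EuclideanSpace ℝ (Fin d)) : ‖v‖ ≤ slNorm M⁻¹ * ‖slAct M v‖ := by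
  simpa only [slAct_inv_slAct] using norm_slAct_le M⁻¹ (slAct M v)

theorem abs_entry_le_slNorm (M : Matrix.SpecialLinearGroup (Fin d) ℝ) (i j : Fin d) :
    |M i j| ≤ slNorm M := by
  have h := norm_slAct_le M (EuclideanSpace.single j 1)
  rw [PiLp.norm_single, norm_one, mul_one] at h
  refine le_trans ?_ h
  rw [← slAct_single, ← Real.norm_eq_abs]
  exact PiLp.norm_apply_le _ _

theorem continuous_entry (i j : Fin d) :
    Continuous fun M : Matrix.SpecialLinearGroup (Fin d) ℝ => M i j :=
  (continuous_subtype_val (p := fun M : Matrix (Fin d) (Fin d) ℝ => M.det = 1)).matrix_elem i j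

end SlAct

/-! ### Diagonal matrices of determinant one -/

namespace Matrix.SpecialLinearGroup

/-- All off-diagonal entries vanish. -/
def IsOffDiagZero {d : ℕ} (M : Matrix.SpecialLinearGroup (Fin d) ℝ) : Prop :=
  ∀ i j, i ≠ j → M i j = 0

variable {d : ℕ}

theorem mul_entry_of_offDiagZero_right (M : Matrix.SpecialLinearGroup (Fin d) ℝ)
    {D : Matrix.SpecialLinearGroup (Fin d) ℝ} (hD : D.IsOffDiagZero) (i j : Fin d) :
    (M * D) i j = M i j * D j j := by
  rw [coe_mul, Matrix.mul_apply, Finset.sum_eq_single j]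
  · intro k _ hk; rw [hD k j hk, mul_zero]
  · simp

theorem mul_entry_of_offDiagZero_left {D : Matrix.SpecialLinearGroup (Fin d) ℝ}
    (hD : D.IsOffDiagZero) (M : Matrix.SpecialLinearGroup (Fin d) ℝ) (i j : Fin d) :
    (D * M) i j = D i i * M i j := by
  rw [coe_mul, Matrix.mul_apply, Finset.sum_eq_single i]
  · intro k _ hk; rw [hD i k hk.symm, zero_mul]
  · simp

theorem IsOffDiagZero.one : (1 : Matrix.SpecialLinearGroup (Fin d) ℝ).IsOffDiagZero :=
  fun i j hij => by simp [Matrix.one_apply_ne hij]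

theorem IsOffDiagZero.mul {M N : Matrix.SpecialLinearGroup (Fin d) ℝ} (hM : M.IsOffDiagZero)
    (hN : N.IsOffDiagZero) : (M * N).IsOffDiagZero := fun i j hij => by
  rw [mul_entry_of_offDiagZero_right M hN, hM i j hij, zero_mul]

theorem IsOffDiagZero.prod_eq_one {D : Matrix.SpecialLinearGroup (Fin d) ℝ}
    (hD : D.IsOffDiagZero) : ∏ i, D i i = 1 := by
  have h : (D : Matrix (Fin d) (Fin d) ℝ) = Matrix.diagonal fun i => D i i := by
    ext i j
    by_cases hij : i = j
    · subst hij; simp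
    · rw [Matrix.diagonal_apply_ne _ hij, hD i j hij]
  rw [← Matrix.det_diagonal, ← h, det_coe]

theorem IsOffDiagZero.entry_ne_zero {D : Matrix.SpecialLinearGroup (Fin d) ℝ}
    (hD : D.IsOffDiagZero) (i : Fin d) : D i i ≠ 0 := fun h => by
  have := hD.prod_eq_one
  rw [Finset.prod_eq_zero (f := fun i => D i i) (Finset.mem_univ i) h] at this
  exact zero_ne_one this

theorem IsOffDiagZero.inv {D : Matrix.SpecialLinearGroup (Fin d) ℝ}
    (hD : D.IsOffDiagZero) : D⁻¹.IsOffDiagZero := fun i j hij => by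
  have h := mul_entry_of_offDiagZero_right D⁻¹ hD i j
  rw [inv_mul_cancel, IsOffDiagZero.one i j hij] at h
  exact (mul_eq_zero.mp h.symm).resolve_right (hD.entry_ne_zero j)

theorem IsOffDiagZero.inv_entry {D : Matrix.SpecialLinearGroup (Fin d) ℝ}
    (hD : D.IsOffDiagZero) (i : Fin d) : D⁻¹ i i = (D i i)⁻¹ := by
  have h := mul_entry_of_offDiagZero_right D⁻¹ hD i i
  rw [inv_mul_cancel, coe_one, Matrix.one_apply_eq] at h
  exact eq_inv_of_mul_eq_one_left h.symm

theorem IsOffDiagZero.slAct_single {D : Matrix.SpecialLinearGroup (Fin d) ℝ}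
    (hD : D.IsOffDiagZero) (i : Fin d) :
    slAct D (EuclideanSpace.single i 1) = D i i • EuclideanSpace.single i (1 : ℝ) := by
  ext j
  rw [_root_.slAct_single]
  by_cases hij : j = i
  · subst hij; simp
  · simp [hD j i hij, hij]

theorem exists_row_ne_zero (M : Matrix.SpecialLinearGroup (Fin d) ℝ) (i : Fin d) :
    ∃ j, M i j ≠ 0 := by
  by_contra! h
  have := M.det_coe
  rw [Matrix.det_eq_zero_of_row_eq_zero i h] at this
  exact zero_ne_one this

theorem exists_col_ne_zero (M : Matrix.SpecialLinearGroup (Fin d) ℝ) (j : Fin d) :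
    ∃ i, M i j ≠ 0 := by
  by_contra! h
  have := M.det_coe
  rw [Matrix.det_eq_zero_of_column_eq_zero j h] at this
  exact zero_ne_one this

end Matrix.SpecialLinearGroup

/-! ### Iterates of cocycles -/

namespace LinCocycle

variable {κ d : ℕ}

theorem iterNat_zero (A : LinCocycle κ d) (ω : FullShift κ) : iterNat A 0 ω = 1 := rfl

theorem iterNat_succ (A : LinCocycle κ d) (n : ℕ) (ω : FullShift κ) :
    iterNat A (n + 1) ω = A (shiftBy n ω) * iterNat A n ω := rfl

theorem iterNat_one (A : LinCocycle κ d) (ω : FullShift κ) : iterNat A 1 ω = A ω := by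
  simp [iterNat_succ, iterNat_zero]

theorem iterNat_add (A : LinCocycle κ d) (m n : ℕ) (ω : FullShift κ) :
    iterNat A (m + n) ω = iterNat A m (shiftBy n ω) * iterNat A n ω := by
  induction m with
  | zero => simp [iterNat_zero]
  | succ m ih =>
    rw [Nat.succ_add, iterNat_succ, iterNat_succ, ih, shiftBy_shiftBy, mul_assoc]
    push_cast; rfl

theorem iterNat_conj {A B C : LinCocycle κ d} (h : ∀ ω, A ω * C ω = C (shift ω) * B ω) (n : ℕ)
    (ω : FullShift κ) : iterNat A n ω * C ω = C (shiftBy n ω) * iterNat B n ω := by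
  induction n with
  | zero => simp [iterNat_zero]
  | succ n ih =>
    rw [iterNat_succ, iterNat_succ, mul_assoc, ih, ← mul_assoc, h, shift_shiftBy, mul_assoc]
    push_cast; rfl

theorem iter_natCast (A : LinCocycle κ d) (n : ℕ) (ω : FullShift κ) :
    iter A n ω = iterNat A n ω := rfl

theorem iter_conj {A B C : LinCocycle κ d} (h : ∀ ω, A ω * C ω = C (shift ω) * B ω) (n : ℤ)
    (ω : FullShift κ) : iter A n ω * C ω = C (shiftBy n ω) * iter B n ω := by
  rcases n with n | n
  · exact iterNat_conj h n ω
  · have key := iterNat_conj h (n + 1) (shiftBy (Int.negSucc n) ω)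
    have hs : shiftBy ((n + 1 : ℕ) : ℤ) (shiftBy (Int.negSucc n) ω) = ω := by
      rw [shiftBy_shiftBy]
      have : ((n + 1 : ℕ) : ℤ) + Int.negSucc n = 0 := by omega
      rw [this, shiftBy_zero]
    rw [hs] at key
    simp only [iter]
    rw [inv_mul_eq_iff_eq_mul, ← mul_assoc, key, mul_inv_cancel_right]

/-- The iterate reads only the symbols `0, …, n - 1`. This is what makes splicing and periodic
closing of words possible. -/
theorem IsLocConst.iterNat_congr {A : LinCocycle κ d} (hA : A.IsLocConst) (n : ℕ)
    {ω ω' : FullShift κ} (h : ∀ j : ℤ, 0 ≤ j → j < n → ω j = ω' j) :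
    iterNat A n ω = iterNat A n ω' := by
  induction n with
  | zero => rfl
  | succ n ih =>
    rw [iterNat_succ, iterNat_succ, ih fun j h0 h1 => h j h0 (by push_cast; omega),
      hA (shiftBy n ω) (shiftBy n ω') (by simpa using h n (by omega) (by push_cast; omega))]

theorem IsLocConst.continuous {A : LinCocycle κ d} (hA : A.IsLocConst) : Continuous A := by
  have h : A = (fun s => A fun _ => s) ∘ fun ω : FullShift κ => ω 0 :=
    funext fun ω => hA _ _ rfl
  rw [h]
  exact continuous_of_discreteTopology.comp (continuous_apply 0)

theorem iterNat_offDiagZero {D : LinCocycle κ d} (hD : ∀ ω, (D ω).IsOffDiagZero) (n : ℕ)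
    (ω : FullShift κ) : (iterNat D n ω).IsOffDiagZero := by
  induction n with
  | zero => exact Matrix.SpecialLinearGroup.IsOffDiagZero.one
  | succ n ih => exact (hD _).mul ih

theorem iter_offDiagZero {D : LinCocycle κ d} (hD : ∀ ω, (D ω).IsOffDiagZero) (n : ℤ)
    (ω : FullShift κ) : (iter D n ω).IsOffDiagZero := by
  rcases n with n | n
  · exact iterNat_offDiagZero hD n ω
  · exact (iterNat_offDiagZero hD _ _).inv

theorem iterNat_entry {D : LinCocycle κ d} (hD : ∀ ω, (D ω).IsOffDiagZero) (n : ℕ)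
    (ω : FullShift κ) (i : Fin d) :
    iterNat D n ω i i = ∏ k ∈ Finset.range n, D (shiftBy k ω) i i := by
  induction n with
  | zero => simp [iterNat_zero]
  | succ n ih =>
    rw [iterNat_succ, Matrix.SpecialLinearGroup.mul_entry_of_offDiagZero_left (hD _), ih,
      Finset.prod_range_succ, mul_comm]

theorem iterNat_add_entry {D : LinCocycle κ d} (hD : ∀ ω, (D ω).IsOffDiagZero) (m n : ℕ)
    (ω : FullShift κ) (i : Fin d) :
    iterNat D (m + n) ω i i = iterNat D m (shiftBy n ω) i i * iterNat D n ω i i := by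
  rw [iterNat_add,
    Matrix.SpecialLinearGroup.mul_entry_of_offDiagZero_left (iterNat_offDiagZero hD _ _)]

theorem iterNat_mul_entry_of_periodic {D : LinCocycle κ d} (hD : ∀ ω, (D ω).IsOffDiagZero)
    {N : ℕ} {p : FullShift κ} (hp : shiftBy N p = p) (k : ℕ) (i : Fin d) :
    iterNat D (k * N) p i i = iterNat D N p i i ^ k := by
  induction k with
  | zero => simp [iterNat_zero]
  | succ k ih => rw [add_mul, one_mul, iterNat_add_entry hD, hp, ih, pow_succ]

end LinCocycle

/-! ### Growth exponents of sums -/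

theorem tendsto_one_div_intCast_atTop : Tendsto (fun n : ℤ => 1 / (n : ℝ)) atTop (𝓝 0) := by
  simp only [one_div]
  exact tendsto_inv_atTop_zero.comp (tendsto_intCast_atTop_atTop (R := ℝ))

theorem tendsto_one_div_intCast_atBot : Tendsto (fun n : ℤ => 1 / (n : ℝ)) atBot (𝓝 0) := by
  simp only [one_div]
  exact tendsto_inv_atBot_zero.comp (tendsto_intCast_atBot_iff.mpr tendsto_id)

theorem tendsto_atTop_int_iff {X : Type*} {f : ℤ → X} {l : Filter X} :
    Tendsto f atTop l ↔ Tendsto (fun n : ℕ => f n) atTop l := by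
  rw [← Nat.map_cast_int_atTop, tendsto_map'_iff]; rfl

theorem abs_log_sub_log_le {x y K : ℝ} (hx : 0 < x) (hy : 0 < y) (hxy : x ≤ K * y)
    (hyx : y ≤ K * x) : |Real.log x - Real.log y| ≤ Real.log K := by
  have hK : 0 < K := pos_of_mul_pos_left (hx.trans_le hxy) hy.le
  have h1 := Real.log_le_log hx hxy
  have h2 := Real.log_le_log hy hyx
  rw [Real.log_mul hK.ne' hy.ne'] at h1
  rw [Real.log_mul hK.ne' hx.ne'] at h2
  rw [abs_le]
  constructor <;> linarith

theorem tendsto_one_div_mul_of_bounded {l : Filter ℤ}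
    (hl : Tendsto (fun n : ℤ => 1 / (n : ℝ)) l (𝓝 0)) {f : ℤ → ℝ} {K : ℝ}
    (hf : ∀ᶠ n in l, |f n| ≤ K) : Tendsto (fun n : ℤ => 1 / (n : ℝ) * f n) l (𝓝 0) := by
  refine squeeze_zero_norm' (a := fun n : ℤ => |1 / (n : ℝ)| * K) ?_ ?_
  · filter_upwards [hf] with n hn
    rw [Real.norm_eq_abs, abs_mul]
    gcongr
  · simpa using hl.abs.mul_const K

section Exponents

variable {W : Type*} [NormedAddCommGroup W]

/-- Eventually the faster term is at least twice the slower one, so adding the latter moves the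
logarithm by at most `log 2`. -/
theorem tendsto_exponent_add {f g : ℤ → W} {a b : ℝ} (hab : b < a) (hf0 : ∀ n, f n ≠ 0)
    (hf : Tendsto (fun n : ℤ => 1 / (n : ℝ) * Real.log ‖f n‖) atTop (𝓝 a))
    (hg : Tendsto (fun n : ℤ => 1 / (n : ℝ) * Real.log ‖g n‖) atTop (𝓝 b)) :
    Tendsto (fun n : ℤ => 1 / (n : ℝ) * Real.log ‖f n + g n‖) atTop (𝓝 a) := by
  obtain ⟨c, hc, hcab⟩ : ∃ c : ℝ, 0 < c ∧ b - a < -c := ⟨(a - b) / 2, by linarith, by linarith⟩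
  have hsmall : ∀ᶠ n : ℤ in atTop, ‖g n‖ ≤ ‖f n‖ / 2 := by
    filter_upwards [(hg.sub hf).eventually_lt_const hcab, eventually_gt_atTop 0,
      (tendsto_intCast_atTop_atTop (R := ℝ)).eventually_ge_atTop (Real.log 2 / c)] with n h1 h2 h3
    have hn : (0 : ℝ) < n := by exact_mod_cast h2
    have hfn : 0 < ‖f n‖ := norm_pos_iff.mpr (hf0 n)
    -- With `Real.log 0 = 0`, the hypothesis on `g` does not exclude zeros, and these have to be
    -- treated separately.
    rcases (norm_nonneg (g n)).eq_or_lt with h0 | h0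
    · rw [← h0]; positivity
    rw [← mul_sub, one_div, inv_mul_lt_iff₀ hn] at h1
    rw [div_le_iff₀ hc] at h3
    refine (Real.log_le_log_iff h0 (by positivity)).mp ?_
    rw [Real.log_div hfn.ne' two_ne_zero]
    linarith
  have hdiff : Tendsto (fun n : ℤ => 1 / (n : ℝ) * (Real.log ‖f n + g n‖ - Real.log ‖f n‖))
      atTop (𝓝 0) := by
    refine tendsto_one_div_mul_of_bounded tendsto_one_div_intCast_atTop (K := Real.log 2) ?_
    filter_upwards [hsmall] with n hn
    have hfn : 0 < ‖f n‖ := norm_pos_iff.mpr (hf0 n)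
    have h1 : ‖f n‖ ≤ ‖f n + g n‖ + ‖g n‖ := norm_le_add_norm_add (f n) (g n)
    have h2 := norm_add_le (f n) (g n)
    exact abs_log_sub_log_le (by linarith) hfn (by linarith) (by linarith)
  have := hdiff.add hf
  rw [zero_add] at this
  exact this.congr fun n => by ring

/-- Terms are added in order of increasing exponent, so each new term strictly dominates the sum of
the earlier ones. -/
theorem tendsto_exponent_sum {ι : Type*} (s : Finset ι) {x : ι → ℤ → W} {a : ι → ℝ}
    (ha : Set.InjOn a s) (hx0 : ∀ i ∈ s, ∀ n, x i n ≠ 0)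
    (hx : ∀ i ∈ s, Tendsto (fun n : ℤ => 1 / (n : ℝ) * Real.log ‖x i n‖) atTop (𝓝 (a i))) :
    s = ∅ ∨ ∃ i ∈ s,
      Tendsto (fun n : ℤ => 1 / (n : ℝ) * Real.log ‖∑ i ∈ s, x i n‖) atTop (𝓝 (a i)) := by
  classical
  refine Finset.induction_on_max_value a s (motive := fun s =>
    Set.InjOn a s → (∀ i ∈ s, ∀ n, x i n ≠ 0) →
    (∀ i ∈ s, Tendsto (fun n : ℤ => 1 / (n : ℝ) * Real.log ‖x i n‖) atTop (𝓝 (a i))) →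
    (s = ∅ ∨ ∃ i ∈ s, Tendsto (fun n : ℤ => 1 / (n : ℝ) * Real.log ‖∑ i ∈ s, x i n‖) atTop
      (𝓝 (a i)))) (fun _ _ _ => Or.inl rfl) ?_ ha hx0 hx
  · intro i s his hmax ih ha hx0 hx
    refine Or.inr ⟨i, Finset.mem_insert_self i s, ?_⟩
    simp only [Finset.sum_insert his]
    have hi := hx i (Finset.mem_insert_self i s)
    rcases ih (ha.mono (by simp)) (fun j hj => hx0 j (Finset.mem_insert_of_mem hj))
      (fun j hj => hx j (Finset.mem_insert_of_mem hj)) with rfl | ⟨j, hj, hjt⟩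
    · simpa using hi
    · refine tendsto_exponent_add (lt_of_le_of_ne (hmax j hj) fun h => his ?_)
        (hx0 i (Finset.mem_insert_self i s)) hi hjt
      rwa [← ha (Finset.mem_insert_of_mem hj) (Finset.mem_insert_self i s) h]

end Exponents

/-! ### Lyapunov exponents: conjugacy and diagonal cocycles -/

namespace LinCocycle

variable {κ d : ℕ}

/-- At a typical point, the exponent of a vector exists and equals that of one of its components in
the splitting. -/
theorem forwardIrregular_subset_nonTypical (A : LinCocycle κ d) :
    A.forwardIrregular ⊆ A.nonTypical := by
  rintro ω ⟨v, hv, hirr⟩ ⟨k, F, l, hF, -, hl, hlim⟩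
  have hvmem : v ∈ ⨆ i, F i := by rw [hF.submodule_iSup_eq_top]; trivial
  obtain ⟨f, hf, rfl⟩ : ∃ f : Fin k → EuclideanSpace ℝ (Fin d), (∀ i, f i ∈ F i) ∧
      ∑ i, f i = v := by
    obtain ⟨f, hf, h⟩ := (Submodule.mem_iSup_iff_exists_finsupp F v).mp hvmem
    exact ⟨f, hf, by rw [← h, Finsupp.sum_fintype _ _ fun _ => rfl]⟩
  have hsum := tendsto_exponent_sum (Finset.univ.filter fun i => f i ≠ 0)
    (x := fun i n => slAct (iter A n ω) (f i)) (a := l) hl.injective.injOn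
    (fun i hi n => slAct_ne_zero _ (Finset.mem_filter.mp hi).2)
    (fun i hi => (hlim i (f i) (hf i) (Finset.mem_filter.mp hi).2).1)
  simp only [← map_sum, Finset.sum_filter_ne_zero] at hsum
  rcases hsum with h | ⟨i, -, h⟩
  · refine hv (Finset.sum_eq_zero fun i hi => ?_)
    by_contra hne
    exact Finset.notMem_empty i (h ▸ Finset.mem_filter.mpr ⟨hi, hne⟩)
  · exact hirr ⟨l i, h⟩

/-- `C` and its inverse are bounded along the orbit of `ω`. -/
def BoundedOnOrbit (C : LinCocycle κ d) (ω : FullShift κ) : Prop :=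
  ∃ K : ℝ, ∀ n : ℤ, slNorm (C (shiftBy n ω)) ≤ K ∧ slNorm (C (shiftBy n ω))⁻¹ ≤ K

theorem exists_slNorm_le_of_continuous {C : LinCocycle κ d} (hC : Continuous C) :
    ∃ K : ℝ, ∀ ω, slNorm (C ω) ≤ K ∧ slNorm (C ω)⁻¹ ≤ K := by
  obtain ⟨K₁, h1⟩ := (isCompact_range (continuous_slNorm.comp hC)).bddAbove
  obtain ⟨K₂, h2⟩ := (isCompact_range (continuous_slNorm.comp hC.inv)).bddAbove
  exact ⟨max K₁ K₂, fun ω => ⟨(h1 ⟨ω, rfl⟩).trans (le_max_left _ _),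
    (h2 ⟨ω, rfl⟩).trans (le_max_right _ _)⟩⟩

theorem boundedOnOrbit_of_continuous {C : LinCocycle κ d} (hC : Continuous C) (ω : FullShift κ) :
    C.BoundedOnOrbit ω :=
  (exists_slNorm_le_of_continuous hC).imp fun _ hK n => hK (shiftBy n ω)

/-- The orbit is finite, so no regularity of `C` is needed. This gives access to the periodic data
of merely cohomologous cocycles. -/
theorem boundedOnOrbit_of_periodic (C : LinCocycle κ d) {N : ℕ} (hN : 0 < N) {p : FullShift κ}
    (hp : shiftBy N p = p) : C.BoundedOnOrbit p := by
  have hper : Function.Periodic (fun n : ℤ => shiftBy n p) (N : ℤ) := fun n => by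
    change shiftBy (n + N) p = shiftBy n p
    rw [← shiftBy_shiftBy, hp]
  have hfin : (Set.range fun n : ℤ => shiftBy n p).Finite := by
    refine ((Set.finite_Ico (0 : ℤ) N).image fun n => shiftBy n p).subset ?_
    rintro _ ⟨n, rfl⟩
    obtain ⟨m, hm, h⟩ := hper.exists_mem_Ico₀ (by exact_mod_cast hN) n
    exact ⟨m, hm, h.symm⟩
  obtain ⟨K₁, h1⟩ := (hfin.image fun ω => slNorm (C ω)).bddAbove
  obtain ⟨K₂, h2⟩ := (hfin.image fun ω => slNorm (C ω)⁻¹).bddAbove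
  exact ⟨max K₁ K₂, fun n => ⟨(h1 ⟨_, ⟨n, rfl⟩, rfl⟩).trans (le_max_left _ _),
    (h2 ⟨_, ⟨n, rfl⟩, rfl⟩).trans (le_max_right _ _)⟩⟩

section Transfer

variable {A B C : LinCocycle κ d} (hconj : ∀ ω, A ω * C ω = C (shift ω) * B ω)
  {ω : FullShift κ} (hC : C.BoundedOnOrbit ω)

include hconj hC

/-- The logarithms of the two norms differ by at most `log K`, which the factor `1 / n` removes. -/
theorem tendsto_finiteExponent_conj_iff {v : EuclideanSpace ℝ (Fin d)} (hv : v ≠ 0)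
    {l : Filter ℤ} (hl : Tendsto (fun n : ℤ => 1 / (n : ℝ)) l (𝓝 0)) {a : ℝ} :
    Tendsto (finiteExponent A ω (slAct (C ω) v)) l (𝓝 a) ↔
      Tendsto (finiteExponent B ω v) l (𝓝 a) := by
  obtain ⟨K, hK⟩ := hC
  have key : Tendsto (fun n => finiteExponent A ω (slAct (C ω) v) n - finiteExponent B ω v n) l
      (𝓝 0) := by
    refine (tendsto_one_div_mul_of_bounded hl (K := Real.log K) (f := fun n =>
      Real.log ‖slAct (C (shiftBy n ω)) (slAct (iter B n ω) v)‖ -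
        Real.log ‖slAct (iter B n ω) v‖) (Eventually.of_forall fun n => ?_)).congr fun n => ?_
    · have hx := slAct_ne_zero (iter B n ω) hv
      refine abs_log_sub_log_le (norm_pos_iff.mpr (slAct_ne_zero _ hx)) (norm_pos_iff.mpr hx)
        ((norm_slAct_le _ _).trans ?_) ((norm_le_slNorm_inv (C (shiftBy n ω)) _).trans ?_)
      · exact mul_le_mul_of_nonneg_right (hK n).1 (norm_nonneg _)
      · exact mul_le_mul_of_nonneg_right (hK n).2 (norm_nonneg _)
    · simp only [finiteExponent]
      rw [← slAct_mul, ← slAct_mul, iter_conj hconj, mul_sub]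
  constructor
  · intro h
    simpa using h.sub key
  · intro h
    simpa using h.add key

theorem lyapunovSpectrum_conj : lyapunovSpectrum A ω = lyapunovSpectrum B ω := by
  ext a
  constructor
  · rintro ⟨v, hv, h⟩
    refine ⟨slAct (C ω)⁻¹ v, slAct_ne_zero _ hv, ?_⟩
    rwa [← tendsto_finiteExponent_conj_iff hconj hC (slAct_ne_zero _ hv)
      tendsto_one_div_intCast_atTop, slAct_slAct_inv]
  · rintro ⟨v, hv, h⟩
    exact ⟨slAct (C ω) v, slAct_ne_zero _ hv, (tendsto_finiteExponent_conj_iff hconj hC hv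
      tendsto_one_div_intCast_atTop).mpr h⟩

end Transfer

theorem finiteExponent_smul (A : LinCocycle κ d) (ω : FullShift κ) {t : ℝ} (ht : t ≠ 0)
    {v : EuclideanSpace ℝ (Fin d)} (hv : v ≠ 0) (n : ℤ) :
    finiteExponent A ω (t • v) n = 1 / (n : ℝ) * Real.log ‖t‖ + finiteExponent A ω v n := by
  rw [finiteExponent, finiteExponent, map_smul, norm_smul,
    Real.log_mul (norm_ne_zero_iff.mpr ht) (norm_ne_zero_iff.mpr (slAct_ne_zero _ hv)), mul_add]

section Diagonal

variable {D : LinCocycle κ d} (hD : ∀ ω, (D ω).IsOffDiagZero) {ω : FullShift κ}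

include hD

theorem finiteExponent_single (i : Fin d) (n : ℤ) :
    finiteExponent D ω (EuclideanSpace.single i 1) n =
      1 / (n : ℝ) * Real.log |iter D n ω i i| := by
  simp [finiteExponent, (iter_offDiagZero hD n ω).slAct_single, norm_smul]

theorem lyapunovSpectrum_of_diagonal {l : Fin d → ℝ} (hl : Function.Injective l)
    (h : ∀ i, Tendsto (fun n : ℤ => 1 / (n : ℝ) * Real.log |iter D n ω i i|) atTop (𝓝 (l i))) :
    lyapunovSpectrum D ω = Set.range l := by
  have hsingle : ∀ i, Tendsto (finiteExponent D ω (EuclideanSpace.single i 1)) atTop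
      (𝓝 (l i)) := fun i => (h i).congr fun n => (finiteExponent_single hD i n).symm
  ext a
  constructor
  · rintro ⟨v, hv, hva⟩
    have hdec : v = ∑ i, v i • EuclideanSpace.single i (1 : ℝ) := by
      ext j; simp [Finset.sum_apply, Pi.single_apply]
    have hscaled : ∀ i, v i ≠ 0 → Tendsto (fun n : ℤ => 1 / (n : ℝ) *
        Real.log ‖slAct (iter D n ω) (v i • EuclideanSpace.single i (1 : ℝ))‖) atTop
        (𝓝 (l i)) := by
      intro i hi
      have := (tendsto_one_div_intCast_atTop.mul_const (Real.log ‖v i‖)).add (hsingle i)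
      rw [zero_mul, zero_add] at this
      refine this.congr fun n => ?_
      exact (finiteExponent_smul D ω hi (by simp) n).symm
    have hsum := tendsto_exponent_sum (Finset.univ.filter fun i => v i ≠ 0)
      (x := fun i n => slAct (iter D n ω) (v i • EuclideanSpace.single i (1 : ℝ))) (a := l)
      hl.injOn (fun i hi n => slAct_ne_zero _ (by simpa using hi))
      (fun i hi => hscaled i (Finset.mem_filter.mp hi).2)
    have hfilter : ∑ i ∈ Finset.univ.filter (fun i => v i ≠ 0),
        v i • EuclideanSpace.single i (1 : ℝ) = v := by
      conv_rhs => rw [hdec]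
      refine Finset.sum_subset (Finset.filter_subset _ _) fun i _ hi => ?_
      have : v i = 0 := by simpa using hi
      rw [this, zero_smul]
    simp only [← map_sum, hfilter] at hsum
    rcases hsum with hs | ⟨i, -, hi⟩
    · refine absurd ?_ hv
      rw [← hfilter, hs, Finset.sum_empty]
    · exact ⟨i, tendsto_nhds_unique hi hva⟩
  · rintro ⟨i, rfl⟩
    exact ⟨EuclideanSpace.single i 1, by simp, hsingle i⟩

theorem log_abs_iterNat_entry (n : ℕ) (i : Fin d) :
    Real.log |iterNat D n ω i i| =
      ∑ k ∈ Finset.range n, Real.log |D (shiftBy k ω) i i| := by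
  rw [iterNat_entry hD, Finset.abs_prod, Real.log_prod]
  exact fun k _ => abs_ne_zero.mpr ((hD _).entry_ne_zero i)

/-- At a periodic point the exponent along the `i`-th axis exists. -/
theorem tendsto_exponent_of_periodic {N : ℕ} (hN : 0 < N) {p : FullShift κ}
    (hp : shiftBy N p = p) (i : Fin d) :
    Tendsto (fun n : ℕ => 1 / (n : ℝ) * Real.log |iterNat D n p i i|) atTop
      (𝓝 (Real.log |iterNat D N p i i| / N)) := by
  set c := Real.log |iterNat D N p i i| / N with hc
  have hN' : (N : ℝ) ≠ 0 := by exact_mod_cast hN.ne'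
  -- With the linear drift `n * c` removed, the logarithm is `N`-periodic in `n`, hence bounded.
  let f : ℕ → ℝ := fun n => Real.log |iterNat D n p i i| - n * c
  have hper : Function.Periodic f N := by
    intro n
    simp only [f]
    rw [iterNat_add_entry hD, hp, abs_mul, Real.log_mul
      (abs_ne_zero.mpr ((iterNat_offDiagZero hD _ _).entry_ne_zero i))
      (abs_ne_zero.mpr ((iterNat_offDiagZero hD _ _).entry_ne_zero i))]
    have : Real.log |iterNat D N p i i| = N * c := by rw [hc]; field_simp
    rw [this]
    push_cast
    ring
  obtain ⟨K, hK⟩ : ∃ K, ∀ n, |f n| ≤ K := by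
    obtain ⟨K, hK⟩ := ((Finset.range N).finite_toSet.image fun n => |f n|).bddAbove
    refine ⟨K, fun n => ?_⟩
    rw [← hper.map_mod_nat n]
    exact hK ⟨n % N, by simpa using Nat.mod_lt n hN, rfl⟩
  have h0 : Tendsto (fun n : ℕ => 1 / (n : ℝ) * f n) atTop (𝓝 0) := by
    have := tendsto_one_div_mul_of_bounded tendsto_one_div_intCast_atTop
      (f := fun n => f n.toNat) (Eventually.of_forall fun n => hK n.toNat)
    rw [tendsto_atTop_int_iff] at this
    simpa using this
  have := h0.add_const c
  rw [zero_add] at this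
  refine this.congr' ?_
  filter_upwards [eventually_gt_atTop 0] with n hn
  have hn' : (n : ℝ) ≠ 0 := by exact_mod_cast hn.ne'
  simp only [f]
  field_simp
  ring

end Diagonal

end LinCocycle

/-! ### Generic divergence of Birkhoff means -/

section Birkhoff

variable {κ : ℕ}

/-- The Birkhoff average of `f` along the first `n` points of the orbit of `ω`. -/
noncomputable def birkhoffMean (f : FullShift κ → ℝ) (n : ℕ) (ω : FullShift κ) : ℝ :=
  (n : ℝ)⁻¹ * ∑ k ∈ Finset.range n, f (shiftBy k ω)

theorem continuous_birkhoffMean {f : FullShift κ → ℝ} (hf : Continuous f) (n : ℕ) :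
    Continuous (birkhoffMean f n) :=
  continuous_const.mul
    (continuous_finsetSum _ fun k _ => hf.comp (continuous_shiftBy k))

/-- From time `M + m` on, the window of radius `M` sees only symbols of `p`. The summands are
therefore asymptotic to those of `p`, and Cesàro averaging preserves this. -/
theorem tendsto_birkhoffMean_splice {f : FullShift κ → ℝ} (hf : Continuous f) {p : FullShift κ}
    {a : ℝ} (hp : Tendsto (fun n => birkhoffMean f n p) atTop (𝓝 a)) (m : ℕ) (ω : FullShift κ) :
    Tendsto (fun n => birkhoffMean f n (splice m ω p)) atTop (𝓝 a) := by
  have h : Tendsto (fun k : ℕ => f (shiftBy k (splice m ω p)) - f (shiftBy k p)) atTop (𝓝 0) := by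
    rw [Metric.tendsto_atTop]
    intro ε hε
    obtain ⟨M, hM⟩ := exists_window hf hε
    refine ⟨M + m, fun k hk => ?_⟩
    rw [Real.dist_0_eq_abs, ← Real.dist_eq]
    refine hM _ _ fun j hj => ?_
    rw [abs_le] at hj
    simp only [shiftBy_apply]
    exact splice_of_le _ _ (by omega)
  have := h.cesaro.add hp
  rw [zero_add] at this
  refine this.congr fun n => ?_
  rw [birkhoffMean, birkhoffMean, ← mul_add, ← Finset.sum_add_distrib]
  simp

/-- Visiting `U` after time `N` is an open condition, and it is dense because the tail of `p` can be
spliced onto any finite word. -/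
theorem eventually_residual_frequently {f : FullShift κ → ℝ} (hf : Continuous f)
    {p : FullShift κ} {a : ℝ} (hp : Tendsto (fun n => birkhoffMean f n p) atTop (𝓝 a))
    {U : Set ℝ} (hU : IsOpen U) (ha : a ∈ U) :
    ∀ᶠ ω in residual (FullShift κ), ∃ᶠ n in atTop, birkhoffMean f n ω ∈ U := by
  simp only [frequently_atTop]
  refine eventually_countable_forall.mpr fun N => ?_
  refine residual_of_dense_open (s := {ω | ∃ n, N ≤ n ∧ birkhoffMean f n ω ∈ U}) ?_ ?_
  · have : {ω | ∃ n, N ≤ n ∧ birkhoffMean f n ω ∈ U} =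
        ⋃ n, ⋃ _ : N ≤ n, birkhoffMean f n ⁻¹' U := by
      ext ω; simp
    rw [this]
    refine isOpen_iUnion fun n => ?_
    by_cases hn : N ≤ n
    · simpa [hn] using hU.preimage (continuous_birkhoffMean hf n)
    · simp [hn]
  · intro ω
    refine mem_closure_of_tendsto (tendsto_splice_right ω p) (Eventually.of_forall fun m => ?_)
    obtain ⟨n, h1, h2⟩ := ((tendsto_birkhoffMean_splice hf hp m ω).eventually
      (hU.mem_nhds ha)).and (eventually_ge_atTop N) |>.exists
    exact ⟨n, h2, h1⟩

theorem residual_not_tendsto_birkhoffMean {f : FullShift κ → ℝ} (hf : Continuous f)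
    {p q : FullShift κ} {a b : ℝ} (hp : Tendsto (fun n => birkhoffMean f n p) atTop (𝓝 a))
    (hq : Tendsto (fun n => birkhoffMean f n q) atTop (𝓝 b)) (hab : a ≠ b) :
    ∀ᶠ ω in residual (FullShift κ),
      ¬ ∃ l, Tendsto (fun n => birkhoffMean f n ω) atTop (𝓝 l) := by
  obtain ⟨U, haU, hU, V, hbV, hV, hUV⟩ := exists_open_nhds_disjoint_closure hab
  filter_upwards [eventually_residual_frequently hf hp hU haU,
    eventually_residual_frequently hf hq hV hbV] with ω h1 h2
  rintro ⟨l, hl⟩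
  exact Set.disjoint_left.mp hUV (mem_closure_of_frequently_of_tendsto h1 hl)
    (mem_closure_of_frequently_of_tendsto h2 hl)

end Birkhoff

/-! ### Continuous sections of line bundles -/

section Sections

variable {κ d : ℕ}

/-- Only finitely many symbols enter, so the map is locally constant and `u` may be arbitrary. -/
theorem continuous_window {X : Type*} [TopologicalSpace X] (m : ℕ) (z : FullShift κ)
    (u : FullShift κ → X) :
    Continuous fun ω : FullShift κ => u fun j => if |j| ≤ m then ω j else z j := by
  have h : IsLocallyConstant fun ω : FullShift κ =>
      (fun j : ℤ => if |j| ≤ m then ω j else z j) := by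
    rw [IsLocallyConstant.iff_eventually_eq]
    intro ω
    have hfin : {j : ℤ | |j| ≤ m}.Finite :=
      (Set.finite_Icc (-(m : ℤ)) m).subset fun j hj => abs_le.mp hj
    have : ∀ᶠ ω' : FullShift κ in 𝓝 ω, ∀ j ∈ {j : ℤ | |j| ≤ m}, ω' j = ω j :=
      (Filter.eventually_all_finite hfin).mpr fun j _ =>
        (continuous_apply j).continuousAt.eventually
          ((isOpen_discrete {ω j}).mem_nhds rfl)
    filter_upwards [this] with ω' hω'
    funext j
    split_ifs with hj
    · exact hω' j hj
    · rfl
  exact (h.comp u).continuous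

/-- A continuous line bundle over the full shift has a continuous nowhere zero section. -/
theorem exists_continuous_section {F : FullShift κ → Submodule ℝ (EuclideanSpace ℝ (Fin d))}
    (hrank : ∀ ω, Module.finrank ℝ (F ω) = 1)
    (hcont : Continuous fun ω => (F ω).starProjection) :
    ∃ v : FullShift κ → EuclideanSpace ℝ (Fin d), Continuous v ∧ ∀ ω, v ω ∈ F ω ∧ v ω ≠ 0 := by
  rcases isEmpty_or_nonempty (FullShift κ) with hemp | ⟨⟨z⟩⟩
  · exact ⟨0, continuous_const, fun ω => hemp.elim ω⟩
  have hu : ∀ ω, ∃ u ∈ F ω, ‖u‖ = 1 := by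
    intro ω
    have : Nontrivial (F ω) :=
      Module.nontrivial_of_finrank_pos (R := ℝ) (by rw [hrank]; exact one_pos)
    obtain ⟨x, hx⟩ := exists_ne (0 : F ω)
    have hx' : ‖(x : EuclideanSpace ℝ (Fin d))‖ ≠ 0 := by simpa using hx
    refine ⟨‖(x : EuclideanSpace ℝ (Fin d))‖⁻¹ • (x : EuclideanSpace ℝ (Fin d)),
      (F ω).smul_mem _ x.2, ?_⟩
    rw [norm_smul, norm_inv, norm_norm, inv_mul_cancel₀ hx']
  choose u huF hu1 using hu
  obtain ⟨m, hm⟩ := exists_window hcont one_pos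
  let r : FullShift κ → FullShift κ := fun ω j => if |j| ≤ m then ω j else z j
  -- A unit vector fixed by one projection cannot be annihilated by another at distance less than
  -- one.
  refine ⟨fun ω => (F ω).starProjection (u (r ω)), hcont.clm_apply (continuous_window m z u),
    fun ω => ⟨Submodule.starProjection_apply_mem _ _, fun h0 => ?_⟩⟩
  have h1 : dist (F (r ω)).starProjection (F ω).starProjection < 1 :=
    hm _ _ fun j hj => if_pos hj
  have h2 := ((F (r ω)).starProjection - (F ω).starProjection).le_opNorm (u (r ω))
  change (F ω).starProjection (u (r ω)) = 0 at h0
  rw [sub_apply, h0, sub_zero,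
    Submodule.starProjection_eq_self_iff.mpr (huF (r ω)), hu1, mul_one, ← dist_eq_norm] at h2
  exact absurd h1 (not_lt.mpr h2)

end Sections

/-! ### Diagonal frames adapted to the splitting -/

namespace LinCocycle

variable {κ d : ℕ}

/-- The columns of `C` diagonalize the cocycle `A`, with diagonal form `D`. -/
structure IsDiagonalFrame (A C D : LinCocycle κ d) : Prop where
  continuous_frame : Continuous C
  continuous_diag : Continuous D
  conj : ∀ ω, A ω * C ω = C (shift ω) * D ω
  offDiagZero : ∀ ω, (D ω).IsOffDiagZero

/-- The `i`-th diagonal entries of the iterates of `D` dominate the `j`-th ones. -/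
def EntryDominates (D : LinCocycle κ d) (i j : Fin d) : Prop :=
  ∃ c θ : ℝ, 0 < c ∧ 0 < θ ∧ θ < 1 ∧ ∀ (n : ℕ) (ω : FullShift κ),
    |iterNat D n ω j j| ≤ c * θ ^ n * |iterNat D n ω i i|

theorem EntryDominates.trans {D : LinCocycle κ d} {i j k : Fin d} (h1 : D.EntryDominates i j)
    (h2 : D.EntryDominates j k) : D.EntryDominates i k := by
  obtain ⟨c, θ, hc, hθ, hθ1, h⟩ := h1
  obtain ⟨c', θ', hc', hθ', hθ1', h'⟩ := h2
  refine ⟨c' * c, θ' * θ, by positivity, by positivity, by nlinarith, fun n ω => ?_⟩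
  refine (h' n ω).trans ?_
  calc c' * θ' ^ n * |iterNat D n ω j j| ≤ c' * θ' ^ n * (c * θ ^ n * |iterNat D n ω i i|) := by
        gcongr; exact h n ω
    _ = c' * c * (θ' * θ) ^ n * |iterNat D n ω i i| := by rw [mul_pow]; ring

theorem IsDiagonalFrame.slAct_iterNat_single {A C D : LinCocycle κ d} (h : IsDiagonalFrame A C D)
    (n : ℕ) (ω : FullShift κ) (i : Fin d) :
    slAct (iterNat A n ω) (slAct (C ω) (EuclideanSpace.single i 1)) =
      iterNat D n ω i i • slAct (C (shiftBy n ω)) (EuclideanSpace.single i 1) := by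
  rw [← slAct_mul, iterNat_conj h.conj, slAct_mul,
    (iterNat_offDiagZero h.offDiagZero n ω).slAct_single, map_smul]

theorem IsDiagonalFrame.slAct_single {A C D : LinCocycle κ d} (h : IsDiagonalFrame A C D)
    (ω : FullShift κ) (i : Fin d) :
    slAct (A ω) (slAct (C ω) (EuclideanSpace.single i 1)) =
      D ω i i • slAct (C (shift ω)) (EuclideanSpace.single i 1) := by
  have := h.slAct_iterNat_single 1 ω i
  rw [iterNat_one, iterNat_one] at this
  exact this

theorem IsDiagonalFrame.entryDominates {A C D : LinCocycle κ d} (h : IsDiagonalFrame A C D)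
    {E : Fin d → FullShift κ → Submodule ℝ (EuclideanSpace ℝ (Fin d))}
    (hCE : ∀ ω i, slAct (C ω) (EuclideanSpace.single i 1) ∈ E i ω) {i j : Fin d}
    (hdom : Dominates A (E i) (E j)) : D.EntryDominates i j := by
  obtain ⟨c, θ, hc, hθ, hθ1, hle⟩ := hdom
  obtain ⟨K, hK⟩ := exists_slNorm_le_of_continuous h.continuous_frame
  have hupper : ∀ ω i, ‖slAct (C ω) (EuclideanSpace.single i (1 : ℝ))‖ ≤ K := fun ω i => by
    have := (norm_slAct_le (C ω) (EuclideanSpace.single i 1)).trans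
      (mul_le_mul_of_nonneg_right (hK ω).1 (norm_nonneg _))
    simpa using this
  have hlower : ∀ ω i, 1 ≤ K * ‖slAct (C ω) (EuclideanSpace.single i (1 : ℝ))‖ := fun ω i => by
    have := (norm_le_slNorm_inv (C ω) (EuclideanSpace.single i 1)).trans
      (mul_le_mul_of_nonneg_right (hK ω).2 (norm_nonneg _))
    simpa using this
  -- Two lower and two upper bounds on column lengths give `K ^ 4`. The maximum with one covers `n =
  -- 0`, about which domination says nothing.
  refine ⟨max (c * K ^ 4) 1, θ, by positivity, hθ, hθ1, fun n ω => ?_⟩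
  rcases Nat.eq_zero_or_pos n with rfl | hn
  · simp [iterNat_zero]
  have hK0 : 0 ≤ K := (norm_nonneg _).trans (hupper ω i)
  have key := hle n hn ω _ (hCE ω i) _ (hCE ω j)
  rw [h.slAct_iterNat_single, h.slAct_iterNat_single, norm_smul, norm_smul, Real.norm_eq_abs,
    Real.norm_eq_abs] at key
  set x := ‖slAct (C ω) (EuclideanSpace.single i (1 : ℝ))‖
  set y := ‖slAct (C (shiftBy n ω)) (EuclideanSpace.single j (1 : ℝ))‖
  calc |iterNat D n ω j j| = |iterNat D n ω j j| * (1 * 1) := by ring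
    _ ≤ |iterNat D n ω j j| * ((K * y) * (K * x)) := by
        gcongr
        · exact hlower _ _
        · exact hlower _ _
    _ = K ^ 2 * (|iterNat D n ω j j| * y * x) := by ring
    _ ≤ K ^ 2 * (c * θ ^ n * (|iterNat D n ω i i| * K * K)) := by
        refine mul_le_mul_of_nonneg_left (key.trans ?_) (by positivity)
        gcongr
        · exact hupper _ _
        · exact hupper _ _
    _ = c * K ^ 4 * θ ^ n * |iterNat D n ω i i| := by ring
    _ ≤ max (c * K ^ 4) 1 * θ ^ n * |iterNat D n ω i i| := by
        gcongr
        exact le_max_left _ _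

theorem exists_smul_eq_of_mem_line {F : Submodule ℝ (EuclideanSpace ℝ (Fin d))}
    (hF : Module.finrank ℝ F = 1) {v w : EuclideanSpace ℝ (Fin d)} (hv : v ∈ F) (hv0 : v ≠ 0)
    (hw : w ∈ F) : ∃ t : ℝ, w = t • v := by
  obtain ⟨t, ht⟩ := (finrank_eq_one_iff_of_nonzero' (⟨v, hv⟩ : F)
    (by simpa [Subtype.ext_iff] using hv0)).mp hF ⟨w, hw⟩
  exact ⟨t, by simpa using (congrArg Subtype.val ht).symm⟩

/-- A splitting into continuous invariant line bundles is spanned by the columns of a continuous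
frame of determinant one. -/
theorem exists_diagonalFrame {A : LinCocycle κ 3} (hA : A.IsLocConst)
    {E : Fin 3 → FullShift κ → Submodule ℝ (EuclideanSpace ℝ (Fin 3))}
    (hE : A.IsFinestDominatedSplitting E) :
    ∃ C D : LinCocycle κ 3, IsDiagonalFrame A C D ∧
      ∀ ω i, slAct (C ω) (EuclideanSpace.single i 1) ∈ E i ω := by
  choose v hvc hv using fun i => exists_continuous_section (hE.one_dim i) (hE.continuous i)
  let F : FullShift κ → Matrix (Fin 3) (Fin 3) ℝ := fun ω => Matrix.of fun r i => v i ω r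
  have hFc : Continuous F := continuous_matrix fun r i =>
    (EuclideanSpace.proj (𝕜 := ℝ) r).continuous.comp (hvc i)
  have hdet : ∀ ω, (F ω).det ≠ 0 := by
    intro ω
    have hli := (hE.splits ω).submodule_iSupIndep.linearIndependent (fun i => E i ω)
      (v := fun i => v i ω) (fun i => (hv i ω).1) (fun i => (hv i ω).2)
    have hli' := hli.map' (WithLp.linearEquiv 2 ℝ (Fin 3 → ℝ)).toLinearMap
      (LinearEquiv.ker _)
    have : IsUnit (F ω) := Matrix.linearIndependent_cols_iff_isUnit.mp hli'
    exact ((Matrix.isUnit_iff_isUnit_det _).mp this).ne_zero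
  -- Rescaling a single column normalizes the determinant and keeps every column in its line.
  let s : FullShift κ → Fin 3 → ℝ := fun ω i => if i = 0 then (F ω).det⁻¹ else 1
  have hsc : ∀ i, Continuous fun ω => s ω i := by
    intro i
    by_cases hi : i = 0
    · simp only [s, hi, if_true]
      exact hFc.matrix_det.inv₀ hdet
    · simpa [s, hi] using continuous_const
  let C : LinCocycle κ 3 := fun ω => ⟨Matrix.of fun r i => s ω i * F ω r i, by
    rw [Matrix.det_mul_row, Finset.prod_ite_eq']
    simp [hdet ω]⟩
  have hCc : Continuous C := Continuous.subtype_mk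
    (continuous_matrix fun r i => (hsc i).mul (hFc.matrix_elem r i)) _
  have hcol : ∀ ω i, slAct (C ω) (EuclideanSpace.single i 1) = s ω i • v i ω := by
    intro ω i
    ext r
    rw [slAct_single]
    rfl
  have hmem : ∀ ω i, slAct (C ω) (EuclideanSpace.single i 1) ∈ E i ω := fun ω i => by
    rw [hcol]
    exact (E i ω).smul_mem _ (hv i ω).1
  refine ⟨C, fun ω => (C (shift ω))⁻¹ * A ω * C ω, ⟨hCc, ?_, fun ω => by group, ?_⟩, hmem⟩
  · exact ((hCc.comp continuous_shift).inv.mul hA.continuous).mul hCc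
  · intro ω j i hji
    have hmem' : slAct (A ω) (slAct (C ω) (EuclideanSpace.single i 1)) ∈ E i (shift ω) := by
      rw [← hE.invariant]
      exact Submodule.mem_map_of_mem (hmem ω i)
    obtain ⟨t, ht⟩ := exists_smul_eq_of_mem_line (hE.one_dim i (shift ω)) (hmem (shift ω) i)
      (slAct_ne_zero _ (by simp)) hmem'
    rw [← _root_.slAct_single, slAct_mul, slAct_mul, ht, map_smul, slAct_inv_slAct]
    simp [hji]

end LinCocycle

/-! ### Dependence of the lines on past and future -/

/-- If `m j ≠ 0` and `m' k ≠ 0`, then up to constants `x i₀ ≤ x' k ≤ x' i₀ ≤ x j`, whereas `x j ≤ c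
* θ ^ n * x i₀`. In the application `m` and `m'` are a row or column of a transition matrix and of
its inverse, and `x`, `x'` are the multipliers at the two points. -/
theorem eq_zero_of_growth {d : ℕ} {i₀ : Fin d} {m m' : Fin d → ℝ} {x x' : ℕ → Fin d → ℝ} {K : ℝ}
    (hx : ∀ n j, 0 < x n j) (hx' : ∀ n j, 0 < x' n j)
    (hdom : ∀ j ≠ i₀, ∃ c θ : ℝ, 0 < c ∧ 0 < θ ∧ θ < 1 ∧ ∀ n, x n j ≤ c * θ ^ n * x n i₀)
    (hdom' : ∀ j ≠ i₀, ∃ c θ : ℝ, 0 < c ∧ 0 < θ ∧ θ < 1 ∧ ∀ n, x' n j ≤ c * θ ^ n * x' n i₀)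
    (hm : ∀ n j, |m j| * x' n i₀ ≤ K * x n j) (hm' : ∀ n j, |m' j| * x n i₀ ≤ K * x' n j)
    (hm0 : ∃ j, m' j ≠ 0) {j : Fin d} (hj : j ≠ i₀) : m j = 0 := by
  by_contra hmj
  obtain ⟨k, hk⟩ := hm0
  have hK : 0 ≤ K := by
    by_contra! hK
    exact absurd (hm 0 j) (not_le.mpr ((mul_neg_of_neg_of_pos hK (hx 0 j)).trans_le
      (mul_nonneg (abs_nonneg _) (hx' 0 i₀).le)))
  obtain ⟨c', hc', hck⟩ : ∃ c' : ℝ, 0 ≤ c' ∧ ∀ n, x' n k ≤ c' * x' n i₀ := by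
    by_cases hki : k = i₀
    · exact ⟨1, zero_le_one, fun n => by rw [hki, one_mul]⟩
    · obtain ⟨c, θ, hc, hθ, hθ1, h⟩ := hdom' k hki
      refine ⟨c, hc.le, fun n => (h n).trans ?_⟩
      refine mul_le_mul_of_nonneg_right ?_ (hx' n i₀).le
      exact mul_le_of_le_one_right hc.le (pow_le_one₀ hθ.le hθ1.le)
  obtain ⟨c, θ, hc, hθ, hθ1, h⟩ := hdom j hj
  have hle : ∀ n : ℕ, |m j| * |m' k| ≤ K * c' * (K * c) * θ ^ n := by
    intro n
    refine le_of_mul_le_mul_right ?_ (hx n i₀)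
    calc |m j| * |m' k| * x n i₀ = |m j| * (|m' k| * x n i₀) := by ring
      _ ≤ |m j| * (K * (c' * x' n i₀)) := by
          exact mul_le_mul_of_nonneg_left
            ((hm' n k).trans (mul_le_mul_of_nonneg_left (hck n) hK)) (abs_nonneg _)
      _ = K * c' * (|m j| * x' n i₀) := by ring
      _ ≤ K * c' * (K * (c * θ ^ n * x n i₀)) := by
          exact mul_le_mul_of_nonneg_left
            ((hm n j).trans (mul_le_mul_of_nonneg_left (h n) hK)) (by positivity)
      _ = K * c' * (K * c) * θ ^ n * x n i₀ := by ring
  have hlim : Tendsto (fun n : ℕ => K * c' * (K * c) * θ ^ n) atTop (𝓝 0) := by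
    simpa using (tendsto_pow_atTop_nhds_zero_of_lt_one hθ.le hθ1).const_mul (K * c' * (K * c))
  have := ge_of_tendsto' hlim hle
  have hpos : 0 < |m j| * |m' k| := mul_pos (abs_pos.mpr hmj) (abs_pos.mpr hk)
  linarith

theorem Matrix.SpecialLinearGroup.entry_congr {d : ℕ} {M N : Matrix.SpecialLinearGroup (Fin d) ℝ}
    (h : M = N) (i j : Fin d) : M i j = N i j := by rw [h]

namespace LinCocycle

variable {κ d : ℕ} {A C D : LinCocycle κ d}

theorem IsDiagonalFrame.exists_transition_bound (h : IsDiagonalFrame A C D) :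
    ∃ K : ℝ, ∀ ω ω' i j, |((C ω')⁻¹ * C ω) i j| ≤ K := by
  have hc : Continuous fun x : FullShift κ × FullShift κ => slNorm ((C x.2)⁻¹ * C x.1) :=
    continuous_slNorm.comp ((h.continuous_frame.comp continuous_snd).inv.mul
      (h.continuous_frame.comp continuous_fst))
  obtain ⟨K, hK⟩ := (isCompact_range hc).bddAbove
  exact ⟨K, fun ω ω' i j => (abs_entry_le_slNorm _ i j).trans (hK ⟨(ω, ω'), rfl⟩)⟩

theorem IsDiagonalFrame.abs_iterNat_pos (h : IsDiagonalFrame A C D) (n : ℕ) (ω : FullShift κ)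
    (i : Fin d) : 0 < |iterNat D n ω i i| :=
  abs_pos.mpr ((iterNat_offDiagZero h.offDiagZero n ω).entry_ne_zero i)

theorem EntryDominates.along {i j : Fin d} (h : D.EntryDominates i j) (ω : ℕ → FullShift κ) :
    ∃ c θ : ℝ, 0 < c ∧ 0 < θ ∧ θ < 1 ∧
      ∀ n, |iterNat D n (ω n) j j| ≤ c * θ ^ n * |iterNat D n (ω n) i i| := by
  obtain ⟨c, θ, hc, hθ, hθ1, h⟩ := h
  exact ⟨c, θ, hc, hθ, hθ1, fun n => h n _⟩

section Dependence

variable (h : IsDiagonalFrame A C D) (hA : A.IsLocConst) {i₀ : Fin d}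
  (hdom : ∀ j ≠ i₀, D.EntryDominates i₀ j) {ω ω' : FullShift κ}

include h hA hdom

/-- The sum of the dominated lines depends only on the future. -/
theorem IsDiagonalFrame.transition_row_eq_zero (hω : ∀ j : ℤ, 0 ≤ j → ω j = ω' j) {j : Fin d}
    (hj : j ≠ i₀) : ((C ω')⁻¹ * C ω) i₀ j = 0 := by
  obtain ⟨K, hK⟩ := h.exists_transition_bound
  have key : ∀ ω ω' : FullShift κ, (∀ j : ℤ, 0 ≤ j → ω j = ω' j) → ∀ (n : ℕ) (j : Fin d),
      |((C ω')⁻¹ * C ω) i₀ j| * |iterNat D n ω' i₀ i₀| ≤ K * |iterNat D n ω j j| := by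
    intro ω ω' hω n j
    -- Equal futures give equal iterates of `A`, so the transition matrices at times `0` and `n`
    -- intertwine the two diagonal iterates.
    have heq : ((C (shiftBy n ω'))⁻¹ * C (shiftBy n ω)) * iterNat D n ω =
        iterNat D n ω' * ((C ω')⁻¹ * C ω) := by
      have h1 := iterNat_conj h.conj n ω
      have h2 := iterNat_conj h.conj n ω'
      rw [hA.iterNat_congr n fun j hj _ => hω j hj] at h1
      rw [mul_assoc, ← h1, inv_mul_eq_iff_eq_mul, ← mul_assoc, ← h2]
      group
    have hent := Matrix.SpecialLinearGroup.entry_congr heq i₀ j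
    rw [Matrix.SpecialLinearGroup.mul_entry_of_offDiagZero_right _
      (iterNat_offDiagZero h.offDiagZero n ω),
      Matrix.SpecialLinearGroup.mul_entry_of_offDiagZero_left
      (iterNat_offDiagZero h.offDiagZero n ω')] at hent
    rw [← abs_mul, mul_comm, ← hent, abs_mul]
    exact mul_le_mul_of_nonneg_right (hK _ _ _ _) (abs_nonneg _)
  refine eq_zero_of_growth (m := fun j => ((C ω')⁻¹ * C ω) i₀ j)
    (m' := fun j => ((C ω)⁻¹ * C ω') i₀ j) (x := fun n j => |iterNat D n ω j j|)
    (x' := fun n j => |iterNat D n ω' j j|) (fun n j => h.abs_iterNat_pos n ω j)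
    (fun n j => h.abs_iterNat_pos n ω' j) (fun j hj => (hdom j hj).along fun _ => ω)
    (fun j hj => (hdom j hj).along fun _ => ω') (key ω ω' hω)
    (key ω' ω fun j hj => (hω j hj).symm)
    (Matrix.SpecialLinearGroup.exists_row_ne_zero _ _) hj

/-- The dominating line depends only on the past. -/
theorem IsDiagonalFrame.transition_col_eq_zero (hω : ∀ j : ℤ, j < 0 → ω j = ω' j) {j : Fin d}
    (hj : j ≠ i₀) : ((C ω')⁻¹ * C ω) j i₀ = 0 := by
  obtain ⟨K, hK⟩ := h.exists_transition_bound
  have key : ∀ ω ω' : FullShift κ, (∀ j : ℤ, j < 0 → ω j = ω' j) → ∀ (n : ℕ) (j : Fin d),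
      |((C ω')⁻¹ * C ω) j i₀| * |iterNat D n (shiftBy (-n) ω) i₀ i₀| ≤
        K * |iterNat D n (shiftBy (-n) ω') j j| := by
    intro ω ω' hω n j
    -- The same intertwining, now from time `-n` to time `0`, which uses only the common past.
    have heq : ((C ω')⁻¹ * C ω) * iterNat D n (shiftBy (-n) ω) =
        iterNat D n (shiftBy (-n) ω') * ((C (shiftBy (-n) ω'))⁻¹ * C (shiftBy (-n) ω)) := by
      have h1 := iterNat_conj h.conj n (shiftBy (-n) ω)
      have h2 := iterNat_conj h.conj n (shiftBy (-n) ω')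
      rw [shiftBy_shiftBy, add_neg_cancel, shiftBy_zero] at h1 h2
      rw [hA.iterNat_congr n (ω' := shiftBy (-n) ω') fun j _ hj => by
        simpa using hω (j + -n) (by omega)] at h1
      rw [mul_assoc, ← h1, inv_mul_eq_iff_eq_mul, ← mul_assoc, ← h2]
      group
    have hent := Matrix.SpecialLinearGroup.entry_congr heq j i₀
    rw [Matrix.SpecialLinearGroup.mul_entry_of_offDiagZero_right _
      (iterNat_offDiagZero h.offDiagZero n _),
      Matrix.SpecialLinearGroup.mul_entry_of_offDiagZero_left
      (iterNat_offDiagZero h.offDiagZero n _)] at hent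
    rw [← abs_mul, hent, abs_mul, mul_comm]
    exact mul_le_mul_of_nonneg_right (hK _ _ _ _) (abs_nonneg _)
  refine eq_zero_of_growth (m := fun j => ((C ω')⁻¹ * C ω) j i₀)
    (m' := fun j => ((C ω)⁻¹ * C ω') j i₀) (x := fun n j => |iterNat D n (shiftBy (-n) ω') j j|)
    (x' := fun n j => |iterNat D n (shiftBy (-n) ω) j j|) (fun n j => h.abs_iterNat_pos n _ j)
    (fun n j => h.abs_iterNat_pos n _ j) (fun j hj => (hdom j hj).along _)
    (fun j hj => (hdom j hj).along _) (key ω ω' hω)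
    (key ω' ω fun j hj => (hω j hj).symm)
    (Matrix.SpecialLinearGroup.exists_col_ne_zero _ _) hj

/-- The dominating line at `ω` is transverse to the sum of the dominated lines at any point. -/
theorem IsDiagonalFrame.transition_entry_ne_zero (ω ω' : FullShift κ) :
    ((C ω')⁻¹ * C ω) i₀ i₀ ≠ 0 := by
  -- Through `η`, with the past of `ω` and the future of `ω'`, the entry becomes a product of two
  -- entries. Each is the only one in its row or column that can be nonzero.
  set η := splice 0 ω ω'
  have hrow : ∀ k ≠ i₀, ((C ω')⁻¹ * C η) i₀ k = 0 := fun k hk =>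
    h.transition_row_eq_zero hA hdom (fun j hj => splice_of_le _ _ hj) hk
  have hcol : ∀ k ≠ i₀, ((C η)⁻¹ * C ω) k i₀ = 0 := fun k hk =>
    h.transition_col_eq_zero hA hdom (fun j hj => (splice_of_lt _ _ hj).symm) hk
  have hprod : (C ω')⁻¹ * C ω = ((C ω')⁻¹ * C η) * ((C η)⁻¹ * C ω) := by group
  rw [hprod, Matrix.SpecialLinearGroup.coe_mul, Matrix.mul_apply,
    Finset.sum_eq_single i₀ (fun k _ hk => by rw [hrow k hk, zero_mul]) (by simp)]
  refine mul_ne_zero (fun h0 => ?_) fun h0 => ?_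
  · obtain ⟨k, hk⟩ := Matrix.SpecialLinearGroup.exists_row_ne_zero ((C ω')⁻¹ * C η) i₀
    by_cases hki : k = i₀
    · exact hk (hki ▸ h0)
    · exact hk (hrow k hki)
  · obtain ⟨k, hk⟩ := Matrix.SpecialLinearGroup.exists_col_ne_zero ((C η)⁻¹ * C ω) i₀
    by_cases hki : k = i₀
    · subst hki; exact hk h0
    · exact hk (hcol k hki)

end Dependence

/-! ### Fixed points and periodic closing of words -/

theorem eq_apply_zero_of_shift_eq {z : FullShift κ} (hz : shift z = z) (j : ℤ) : z j = z 0 := by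
  have hstep : ∀ j : ℤ, z (j + 1) = z j := fun j => congrFun hz j
  induction j using Int.induction_on with
  | zero => rfl
  | succ n ih => rw [hstep, ih]
  | pred n ih => rw [← ih, ← hstep (-n - 1), sub_add_cancel]

theorem shiftBy_eq_of_shift_eq {z : FullShift κ} (hz : shift z = z) (n : ℤ) : shiftBy n z = z := by
  funext j
  rw [shiftBy_apply, eq_apply_zero_of_shift_eq hz, eq_apply_zero_of_shift_eq hz j]

theorem iterNat_entry_of_shift_eq (hD : ∀ ω, (D ω).IsOffDiagZero) {z : FullShift κ}
    (hz : shift z = z) (n : ℕ) (i : Fin d) : iterNat D n z i i = D z i i ^ n := by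
  rw [iterNat_entry hD]
  simp [shiftBy_eq_of_shift_eq hz]

/-- The periodic sequence that repeats the first `m` symbols of `ω`, preceded and followed by `n`
symbols of `z`. -/
def periodicInsert (z ω : FullShift κ) (m n : ℕ) : FullShift κ := fun j =>
  if n ≤ j % ((n + m + n : ℕ) : ℤ) ∧ j % ((n + m + n : ℕ) : ℤ) < n + m then
    ω (j % ((n + m + n : ℕ) : ℤ) - n) else z 0

theorem shiftBy_periodicInsert (z ω : FullShift κ) (m n : ℕ) :
    shiftBy ((n + m + n : ℕ) : ℤ) (periodicInsert z ω m n) = periodicInsert z ω m n := by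
  funext j
  simp only [shiftBy_apply, periodicInsert, Int.add_emod_right]

theorem periodicInsert_of_lt {z ω : FullShift κ} {m n : ℕ} {j : ℤ} (h0 : 0 ≤ j) (h1 : j < n) :
    periodicInsert z ω m n j = z 0 := by
  rw [periodicInsert, Int.emod_eq_of_lt h0 (by push_cast; omega), if_neg (by omega)]

theorem periodicInsert_of_mem {z ω : FullShift κ} {m n : ℕ} {j : ℤ} (h0 : 0 ≤ j) (h1 : j < m) :
    periodicInsert z ω m n (j + n) = ω j := by
  rw [periodicInsert, Int.emod_eq_of_lt (by omega) (by push_cast; omega), if_pos (by omega),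
    add_sub_cancel_right]

theorem periodicInsert_of_le {z ω : FullShift κ} {m n : ℕ} {j : ℤ} (h0 : 0 ≤ j) (h1 : j < n) :
    periodicInsert z ω m n (j + (n + m : ℕ)) = z 0 := by
  rw [periodicInsert, Int.emod_eq_of_lt (by omega) (by push_cast; omega),
    if_neg (by push_cast; omega)]

theorem periodicInsert_of_neg {z ω : FullShift κ} {m n : ℕ} {j : ℤ} (h0 : j < 0) (h1 : -n ≤ j) :
    periodicInsert z ω m n j = z 0 := by
  have h : periodicInsert z ω m n j = periodicInsert z ω m n (j + n + (n + m : ℕ)) := by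
    conv_lhs => rw [← shiftBy_periodicInsert, shiftBy_apply]
    congr 1
    push_cast; ring
  rw [h, periodicInsert_of_le (by omega) (by omega)]

/-- The inserted word and its periodic copies avoid the positions from `-n` to `n - 1`, where only
the symbol of `z` occurs. -/
theorem tendsto_periodicInsert {z : FullShift κ} (hz : shift z = z) (ω : FullShift κ) (m : ℕ) :
    Tendsto (periodicInsert z ω m) atTop (𝓝 z) := by
  refine tendsto_of_eventually_eq fun j => ?_
  filter_upwards [eventually_gt_atTop j.natAbs] with n hn
  rw [eq_apply_zero_of_shift_eq hz]
  rcases lt_or_ge j 0 with hj | hj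
  · exact periodicInsert_of_neg hj (by omega)
  · exact periodicInsert_of_lt hj (by omega)

/-! ### The cohomological equation for the dominating line -/

section Scaling

variable (h : IsDiagonalFrame A C D) (hA : A.IsLocConst) {i₀ : Fin d}
  (hdom : ∀ j ≠ i₀, D.EntryDominates i₀ j) {z : FullShift κ} (hz : shift z = z)
  {χ : ℝ →*₀ ℝ} (hχ : Continuous χ)
  (hper : ∀ (N : ℕ) (p : FullShift κ), shiftBy N p = p →
    χ (iterNat D N p i₀ i₀) = χ (D z i₀ i₀) ^ N)

include h hA hdom hz hχ hper

/-- Closing the word by `n` symbols of `z` on each side gives a periodic point with multiplier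
asymptotic to `b ^ (2 * n) * P i₀ i₀`: the point tends to `z`, and the other multipliers of `z` are
negligible against `b ^ n`. The periodic data give the value of `χ` on this multiplier. -/
theorem IsDiagonalFrame.map_homoclinic_entry (m : ℕ) (ω : FullShift κ) :
    χ (((C z)⁻¹ * iterNat A m ω * C z) i₀ i₀) = χ (D z i₀ i₀) ^ m := by
  set b := D z i₀ i₀ with hb
  have hb0 : b ≠ 0 := (h.offDiagZero z).entry_ne_zero i₀
  have hχb : χ b ≠ 0 := (map_ne_zero χ).mpr hb0
  set P := (C z)⁻¹ * iterNat A m ω * C z with hP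
  let q : ℕ → FullShift κ := periodicInsert z ω m
  let Q : ℕ → Matrix.SpecialLinearGroup (Fin d) ℝ := fun n => (C z)⁻¹ * C (q n)
  have hQ : Tendsto Q atTop (𝓝 1) := by
    have := ((h.continuous_frame.tendsto z).comp (tendsto_periodicInsert hz ω m)).const_mul
      (C z)⁻¹
    rwa [inv_mul_cancel] at this
  have hQent : ∀ j, Tendsto (fun n => Q n j i₀) atTop
      (𝓝 ((1 : Matrix.SpecialLinearGroup (Fin d) ℝ) j i₀)) := fun j =>
    ((continuous_entry j i₀).tendsto _).comp hQ
  -- Both sides equal `(C z)⁻¹ * iterNat A (n + m + n) (q n) * C (q n)`: on the left split into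
  -- three blocks, on the right diagonalized at `q n`.
  have hmat : ∀ n, iterNat D n z * (P * (iterNat D n z * Q n)) =
      Q n * iterNat D (n + m + n) (q n) := by
    intro n
    have hz' := iterNat_conj h.conj n z
    rw [shiftBy_eq_of_shift_eq hz] at hz'
    have hDz : iterNat D n z = (C z)⁻¹ * iterNat A n z * C z := by
      rw [mul_assoc, hz', inv_mul_cancel_left]
    have hq := iterNat_conj h.conj (n + m + n) (q n)
    rw [shiftBy_periodicInsert] at hq
    have hsplit : iterNat A (n + m + n) (q n) =
        iterNat A n z * (iterNat A m ω * iterNat A n z) := by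
      rw [add_assoc, iterNat_add, iterNat_add]
      congr 1
      · refine hA.iterNat_congr n fun j h0 h1 => ?_
        rw [shiftBy_apply, eq_apply_zero_of_shift_eq hz j, add_comm m n]
        exact periodicInsert_of_le h0 h1
      congr 1
      · exact hA.iterNat_congr m fun j h0 h1 => periodicInsert_of_mem h0 h1
      · refine hA.iterNat_congr n fun j h0 h1 => ?_
        rw [eq_apply_zero_of_shift_eq hz j]
        exact periodicInsert_of_lt h0 h1
    rw [mul_assoc (C z)⁻¹, ← hq, hsplit, hDz, hP]
    simp only [Q]
    group
  have hscal : ∀ n, b ^ n * ∑ j, P i₀ j * (iterNat D n z j j * Q n j i₀) =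
      Q n i₀ i₀ * iterNat D (n + m + n) (q n) i₀ i₀ := by
    intro n
    have := Matrix.SpecialLinearGroup.entry_congr (hmat n) i₀ i₀
    rw [Matrix.SpecialLinearGroup.mul_entry_of_offDiagZero_left
      (iterNat_offDiagZero h.offDiagZero n z),
      Matrix.SpecialLinearGroup.mul_entry_of_offDiagZero_right _
      (iterNat_offDiagZero h.offDiagZero _ _), Matrix.SpecialLinearGroup.coe_mul P,
      Matrix.mul_apply, iterNat_entry_of_shift_eq h.offDiagZero hz] at this
    simpa only [Matrix.SpecialLinearGroup.mul_entry_of_offDiagZero_left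
      (iterNat_offDiagZero h.offDiagZero n z)] using this
  -- After division by `b ^ (2 * n)`, only the summand `j = i₀` survives in the limit.
  let S : ℕ → ℝ := fun n => ∑ j, P i₀ j * (iterNat D n z j j / b ^ n * Q n j i₀)
  have hS : ∀ n, b ^ (2 * n) * S n = Q n i₀ i₀ * iterNat D (n + m + n) (q n) i₀ i₀ := by
    intro n
    rw [← hscal, two_mul, pow_add, mul_assoc, Finset.mul_sum]
    congr 1
    refine Finset.sum_congr rfl fun j _ => ?_
    have := pow_ne_zero n hb0
    field_simp
  have hSlim : Tendsto S atTop (𝓝 (P i₀ i₀)) := by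
    have hterm : ∀ j, Tendsto (fun n => P i₀ j * (iterNat D n z j j / b ^ n * Q n j i₀)) atTop
        (𝓝 (if j = i₀ then P i₀ i₀ else 0)) := by
      intro j
      by_cases hj : j = i₀
      · subst hj
        have := (hQent j).const_mul (P j j)
        rw [Matrix.SpecialLinearGroup.coe_one, Matrix.one_apply_eq, mul_one] at this
        rw [if_pos rfl]
        refine this.congr fun n => ?_
        rw [iterNat_entry_of_shift_eq h.offDiagZero hz, ← hb, div_self (pow_ne_zero n hb0), one_mul]
      · rw [if_neg hj]
        obtain ⟨c, θ, hc, hθ, hθ1, hle⟩ := hdom j hj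
        have hratio : Tendsto (fun n => iterNat D n z j j / b ^ n) atTop (𝓝 0) := by
          refine squeeze_zero_norm (a := fun n => c * θ ^ n) (fun n => ?_)
            (by simpa using (tendsto_pow_atTop_nhds_zero_of_lt_one hθ.le hθ1).const_mul c)
          rw [Real.norm_eq_abs, abs_div, div_le_iff₀ (abs_pos.mpr (pow_ne_zero n hb0)), hb,
            ← iterNat_entry_of_shift_eq h.offDiagZero hz]
          exact hle n z
        simpa using (hratio.mul (hQent j)).const_mul (P i₀ j)
    simpa using tendsto_finsetSum Finset.univ fun j _ => hterm j
  have hχS : ∀ n, χ (S n) = χ b ^ m * χ (Q n i₀ i₀) := by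
    intro n
    have := congrArg χ (hS n)
    rw [map_mul, map_mul, map_pow, hper _ _ (shiftBy_periodicInsert z ω m n)] at this
    refine mul_left_cancel₀ (pow_ne_zero (2 * n) hχb) (this.trans ?_)
    ring
  have h1 := (hχ.tendsto _).comp hSlim
  have h2 := ((hχ.tendsto _).comp (hQent i₀)).const_mul (χ b ^ m)
  rw [Matrix.SpecialLinearGroup.coe_one, Matrix.one_apply_eq, map_one, mul_one] at h2
  exact tendsto_nhds_unique h1 (h2.congr fun n => (hχS n).symm)

/-- If the multipliers of the dominating line over periodic orbits are (up to `χ`) those of a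
constant, then the multiplier is cohomologous to that constant (up to `χ`). -/
theorem IsDiagonalFrame.exists_scaling_of_dominating :
    ∃ g : FullShift κ → ℝ, Continuous g ∧ (∀ ω, g ω ≠ 0) ∧
      ∀ ω, χ (D ω i₀ i₀ * g (shift ω)) = χ (D z i₀ i₀) * χ (g ω) := by
  -- The component of the dominating line at `ω` along that at `z`, modulo the dominated lines at
  -- `z`.
  let g : FullShift κ → ℝ := fun ω => ((C z)⁻¹ * C ω) i₀ i₀
  have hg : Continuous g := (continuous_entry i₀ i₀).comp (continuous_const.mul h.continuous_frame)
  refine ⟨g, hg, fun ω => h.transition_entry_ne_zero hA hdom ω z, fun ω => ?_⟩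
  -- The equation is first proved for sequences equal to `z` before `-m`, which approximate `ω`.
  -- Moved `m` steps back, such a sequence has the past of `z`, hence the dominating line of `z`.
  have key : ∀ m : ℕ, χ (D (splice (-m) z ω) i₀ i₀ * g (shift (splice (-m) z ω))) =
      χ (D z i₀ i₀) * χ (g (splice (-m) z ω)) := by
    intro m
    set ω' := splice (-m) z ω
    set η := shiftBy (-m) ω' with hη
    have hηω : shiftBy m η = ω' := by rw [hη, shiftBy_shiftBy, add_neg_cancel, shiftBy_zero]
    set t := ((C z)⁻¹ * C η) i₀ i₀
    have hcol : ∀ k ≠ i₀, ((C z)⁻¹ * C η) k i₀ = 0 := fun k hk => by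
      refine h.transition_col_eq_zero hA hdom (fun j hj => ?_) hk
      rw [hη, shiftBy_apply, eq_apply_zero_of_shift_eq hz j,
        ← eq_apply_zero_of_shift_eq hz (j + -m)]
      exact splice_of_lt _ _ (by omega)
    have hent : ∀ n : ℕ, ((C z)⁻¹ * iterNat A n η * C z) i₀ i₀ * t =
        g (shiftBy n η) * iterNat D n η i₀ i₀ := by
      intro n
      have hmat : ((C z)⁻¹ * iterNat A n η * C z) * ((C z)⁻¹ * C η) =
          ((C z)⁻¹ * C (shiftBy n η)) * iterNat D n η := by
        rw [mul_assoc (C z)⁻¹ (C (shiftBy n η)), ← iterNat_conj h.conj]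
        group
      have := Matrix.SpecialLinearGroup.entry_congr hmat i₀ i₀
      rw [Matrix.SpecialLinearGroup.mul_entry_of_offDiagZero_right _
        (iterNat_offDiagZero h.offDiagZero _ _), Matrix.SpecialLinearGroup.coe_mul (_ * C z),
        Matrix.mul_apply, Finset.sum_eq_single i₀ (fun k _ hk => by rw [hcol k hk, mul_zero])
        (by simp)] at this
      exact this
    -- The identities for `m` and `m + 1` share the unknown `t`; eliminating it leaves the
    -- cohomological equation at `ω'`.
    have h1 := congrArg χ (hent m)
    have h2 := congrArg χ (hent (m + 1))
    have hsucc : iterNat D (m + 1) η i₀ i₀ = D ω' i₀ i₀ * iterNat D m η i₀ i₀ := by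
      rw [iterNat_succ, Matrix.SpecialLinearGroup.mul_entry_of_offDiagZero_left (h.offDiagZero _),
        hηω]
    have hshift : shiftBy ((m + 1 : ℕ) : ℤ) η = shift ω' := by
      rw [← hηω, shift_shiftBy]; push_cast; rfl
    rw [hsucc, hshift, map_mul, h.map_homoclinic_entry hA hdom hz hχ hper, map_mul, map_mul] at h2
    rw [hηω, map_mul, h.map_homoclinic_entry hA hdom hz hχ hper, map_mul] at h1
    have hd : χ (iterNat D m η i₀ i₀) ≠ 0 :=
      (map_ne_zero χ).mpr ((iterNat_offDiagZero h.offDiagZero _ _).entry_ne_zero i₀)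
    refine mul_right_cancel₀ hd ?_
    rw [map_mul, mul_assoc, mul_assoc, ← h1]
    linear_combination -h2
  have hlim := tendsto_splice_left ω z
  have hl := (hχ.comp (((continuous_entry i₀ i₀).comp h.continuous_diag).mul
    (hg.comp continuous_shift))).tendsto ω |>.comp hlim
  have hr := ((continuous_const (y := χ (D z i₀ i₀))).mul (hχ.comp hg)).tendsto ω |>.comp hlim
  exact tendsto_nhds_unique hl (hr.congr fun m => (key m).symm)

end Scaling

end LinCocycle

/-! ### Time reversal and rescaling of the frame -/

namespace FullShift

variable {κ : ℕ}

/-- Time reversal on the full shift, exchanging the strict past and the future. -/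
def reflect (ω : FullShift κ) : FullShift κ := fun i => ω (-1 - i)

theorem continuous_reflect : Continuous (reflect : FullShift κ → FullShift κ) :=
  continuous_pi fun i => continuous_apply (-1 - i)

@[simp] theorem reflect_reflect (ω : FullShift κ) : reflect (reflect ω) = ω := by
  funext i; simp [reflect]

theorem reflect_shiftBy (n : ℤ) (ω : FullShift κ) :
    reflect (shiftBy n ω) = shiftBy (-n) (reflect ω) := by
  funext i
  simp only [reflect, shiftBy_apply]
  congr 1; ring

end FullShift

namespace LinCocycle

variable {κ d : ℕ}

/-- The diagonal form of the time-reversed cocycle. -/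
def reversedDiagonal (D : LinCocycle κ d) : LinCocycle κ d :=
  fun ω => (D (shiftBy (-1) (reflect ω)))⁻¹

theorem iterNat_reversedDiagonal (D : LinCocycle κ d) (n : ℕ) (ω : FullShift κ) :
    iterNat D.reversedDiagonal n ω = (iterNat D n (shiftBy (-n) (reflect ω)))⁻¹ := by
  induction n with
  | zero => simp [iterNat_zero]
  | succ n ih =>
    rw [iterNat_succ, ih, iterNat_add, iterNat_one, shiftBy_shiftBy, mul_inv_rev, reversedDiagonal,
      reflect_shiftBy, shiftBy_shiftBy]
    congr 3
    · push_cast; congr 1; ring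
    · congr 2; push_cast; ring

/-- Reflection exchanges the positions `-1` and `0`, so inverting `A` one step back reads exactly
the symbol `ω 0`, and the reversed cocycle is `A⁻¹` over the same shift. -/
theorem IsDiagonalFrame.reverse {A C D : LinCocycle κ d} (h : IsDiagonalFrame A C D)
    (hA : A.IsLocConst) :
    IsDiagonalFrame (fun ω => (A ω)⁻¹) (fun ω => C (reflect ω)) D.reversedDiagonal where
  continuous_frame := h.continuous_frame.comp continuous_reflect
  continuous_diag := (h.continuous_diag.comp
    ((continuous_shiftBy (-1)).comp continuous_reflect)).inv
  conj ω := by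
    have h1 := h.conj (shiftBy (-1) (reflect ω))
    rw [shift_shiftBy, neg_add_cancel, shiftBy_zero,
      hA (shiftBy (-1) (reflect ω)) ω (by simp [reflect])] at h1
    rw [reversedDiagonal, shift, reflect_shiftBy, inv_mul_eq_iff_eq_mul, ← mul_assoc, h1,
      mul_inv_cancel_right]
  offDiagZero ω := (h.offDiagZero _).inv

theorem EntryDominates.reverse {D : LinCocycle κ d} (hD : ∀ ω, (D ω).IsOffDiagZero)
    {i j : Fin d} (h : D.EntryDominates i j) : D.reversedDiagonal.EntryDominates j i := by
  obtain ⟨c, θ, hc, hθ, hθ1, h⟩ := h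
  refine ⟨c, θ, hc, hθ, hθ1, fun n ω => ?_⟩
  have hoff := iterNat_offDiagZero hD n (shiftBy (-n) (reflect ω))
  rw [iterNat_reversedDiagonal, hoff.inv_entry, hoff.inv_entry, abs_inv, abs_inv]
  have hi := abs_pos.mpr (hoff.entry_ne_zero i)
  have hj := abs_pos.mpr (hoff.entry_ne_zero j)
  have := h n (shiftBy (-n) (reflect ω))
  rw [← div_eq_mul_inv, le_div_iff₀ hj, inv_mul_le_iff₀ hi]
  linarith

section Scaling

variable {A C D : LinCocycle κ d} (h : IsDiagonalFrame A C D) (hA : A.IsLocConst)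
  {i₀ : Fin d} (hdom : ∀ j ≠ i₀, D.EntryDominates j i₀) {z : FullShift κ} (hz : shift z = z)
  {χ : ℝ →*₀ ℝ} (hχ : Continuous χ)
  (hper : ∀ (N : ℕ) (p : FullShift κ), shiftBy N p = p →
    χ (iterNat D N p i₀ i₀) = χ (D z i₀ i₀) ^ N)

include h hA hdom hz hχ hper

/-- Under time reversal the weakest line dominates, and the multipliers of periodic orbits are
inverted, so the hypothesis on them persists. -/
theorem IsDiagonalFrame.exists_scaling_of_dominated :
    ∃ g : FullShift κ → ℝ, Continuous g ∧ (∀ ω, g ω ≠ 0) ∧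
      ∀ ω, χ (D ω i₀ i₀ * g (shift ω)) = χ (D z i₀ i₀) * χ (g ω) := by
  have hzr : shiftBy (-1) (reflect z) = z := by
    funext j
    simp only [shiftBy_apply, reflect]
    rw [eq_apply_zero_of_shift_eq hz, eq_apply_zero_of_shift_eq hz j]
  have hDz : D.reversedDiagonal z i₀ i₀ = (D z i₀ i₀)⁻¹ := by
    rw [reversedDiagonal, hzr, (h.offDiagZero z).inv_entry]
  obtain ⟨g, hg, hg0, hgD⟩ := (h.reverse hA).exists_scaling_of_dominating
    (fun ω ω' hω => by rw [hA ω ω' hω]) (fun j hj => (hdom j hj).reverse h.offDiagZero) hz hχ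
    (fun N p hp => by
      have hp' : shiftBy (-N) (reflect p) = reflect p := by rw [← reflect_shiftBy, hp]
      rw [iterNat_reversedDiagonal, hp', hDz,
        (iterNat_offDiagZero h.offDiagZero _ _).inv_entry, map_inv₀, map_inv₀, inv_pow, hper]
      conv_lhs => rw [← hp', shiftBy_shiftBy, add_neg_cancel, shiftBy_zero])
  refine ⟨fun ω => g (reflect ω), hg.comp continuous_reflect, fun ω => hg0 _, fun ω => ?_⟩
  -- At this point the reversed diagonal is the inverse of `D ω`.
  have key := hgD (reflect (shift ω))
  have h1 : shift (reflect (shift ω)) = reflect ω := by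
    rw [shift, shift, reflect_shiftBy, shiftBy_shiftBy, add_neg_cancel, shiftBy_zero]
  have h2 : D.reversedDiagonal (reflect (shift ω)) i₀ i₀ = (D ω i₀ i₀)⁻¹ := by
    rw [reversedDiagonal, reflect_reflect, shiftBy_shift, neg_add_cancel, shiftBy_zero,
      (h.offDiagZero ω).inv_entry]
  rw [h1, h2, hDz, map_mul, map_inv₀, map_inv₀] at key
  have hd : χ (D ω i₀ i₀) ≠ 0 := (map_ne_zero χ).mpr ((h.offDiagZero ω).entry_ne_zero i₀)
  have hd' : χ (D z i₀ i₀) ≠ 0 := (map_ne_zero χ).mpr ((h.offDiagZero z).entry_ne_zero i₀)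
  rw [map_mul]
  field_simp at key
  linear_combination -key

end Scaling

/-- If all multipliers over periodic orbits are, up to `χ`, those of a fixed point, then the frame
can be rescaled so that the diagonal form is constant, up to `χ`. -/
theorem IsDiagonalFrame.exists_rescaled_frame {A C D : LinCocycle κ 3}
    (h : IsDiagonalFrame A C D) (hA : A.IsLocConst)
    (hdom : ∀ i j : Fin 3, i < j → D.EntryDominates i j) {z : FullShift κ} (hz : shift z = z)
    {χ : ℝ →*₀ ℝ} (hχ : Continuous χ)
    (hper : ∀ (N : ℕ) (p : FullShift κ) (i : Fin 3), shiftBy N p = p →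
      χ (iterNat D N p i i) = χ (D z i i) ^ N) :
    ∃ S : LinCocycle κ 3, (∀ ω, (S ω).IsOffDiagZero) ∧ ∃ B : LinCocycle κ 3,
      IsDiagonalFrame A (fun ω => C ω * S ω) B ∧ ∀ ω i, χ (B ω i i) = χ (D z i i) := by
  obtain ⟨g, hg, hg0, hgD⟩ := h.exists_scaling_of_dominating hA (i₀ := 0)
    (fun j hj => hdom 0 j (Fin.pos_iff_ne_zero.mpr hj)) hz hχ fun N p => hper N p 0
  obtain ⟨g', hg', hg0', hgD'⟩ := h.exists_scaling_of_dominated hA (i₀ := 2)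
    (fun j hj => hdom j 2 (lt_of_le_of_ne (Fin.le_last j) hj)) hz hχ fun N p => hper N p 2
  -- The outer lines are scaled by their transfer functions. The middle factor is forced by
  -- determinant one.
  let s : FullShift κ → Fin 3 → ℝ := fun ω => ![(g ω)⁻¹, g ω * g' ω, (g' ω)⁻¹]
  let S : LinCocycle κ 3 := fun ω => ⟨Matrix.diagonal (s ω), by
    have := hg0 ω
    have := hg0' ω
    rw [Matrix.det_diagonal, Fin.prod_univ_three]
    simp only [s, Matrix.cons_val]
    field_simp⟩
  have hSoff : ∀ ω, (S ω).IsOffDiagZero := fun ω i j hij => Matrix.diagonal_apply_ne _ hij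
  have hSent : ∀ ω i, S ω i i = s ω i := fun ω i => Matrix.diagonal_apply_eq _ i
  have hSc : Continuous S := by
    refine Continuous.subtype_mk (Continuous.matrix_diagonal (continuous_pi fun i => ?_)) _
    fin_cases i
    · exact hg.inv₀ hg0
    · exact hg.mul hg'
    · exact hg'.inv₀ hg0'
  let B : LinCocycle κ 3 := fun ω => (S (shift ω))⁻¹ * D ω * S ω
  have hBoff : ∀ ω, (B ω).IsOffDiagZero := fun ω =>
    ((hSoff _).inv.mul (h.offDiagZero ω)).mul (hSoff ω)
  have hBent : ∀ ω i, B ω i i = (s (shift ω) i)⁻¹ * D ω i i * s ω i := fun ω i => by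
    rw [Matrix.SpecialLinearGroup.mul_entry_of_offDiagZero_right _ (hSoff ω),
      Matrix.SpecialLinearGroup.mul_entry_of_offDiagZero_right _ (h.offDiagZero ω),
      (hSoff _).inv_entry, hSent, hSent]
  refine ⟨S, hSoff, B, ⟨h.continuous_frame.mul hSc,
    ((hSc.comp continuous_shift).inv.mul h.continuous_diag).mul hSc, fun ω => ?_, hBoff⟩, ?_⟩
  · simp only [B]
    rw [← mul_assoc, h.conj]
    group
  intro ω
  have h0 : χ (B ω 0 0) = χ (D z 0 0) := by
    have hχg : χ (g ω) ≠ 0 := (map_ne_zero χ).mpr (hg0 ω)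
    rw [hBent]
    simp only [s, Matrix.cons_val, inv_inv]
    rw [map_mul, mul_comm (g _), hgD, map_inv₀, mul_inv_cancel_right₀ hχg]
  have h2 : χ (B ω 2 2) = χ (D z 2 2) := by
    have hχg : χ (g' ω) ≠ 0 := (map_ne_zero χ).mpr (hg0' ω)
    rw [hBent]
    simp only [s, Matrix.cons_val, inv_inv]
    rw [map_mul, mul_comm (g' _), hgD', map_inv₀, mul_inv_cancel_right₀ hχg]
  -- Both diagonals have product one, so agreement of the outer entries under `χ` gives that of the
  -- middle ones.
  have h1 : χ (B ω 1 1) = χ (D z 1 1) := by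
    have hB := congrArg χ (hBoff ω).prod_eq_one
    have hD := congrArg χ (h.offDiagZero z).prod_eq_one
    rw [Fin.prod_univ_three, map_mul, map_mul] at hB hD
    have hne0 : χ (D z 0 0) ≠ 0 := (map_ne_zero χ).mpr ((h.offDiagZero z).entry_ne_zero 0)
    have hne2 : χ (D z 2 2) ≠ 0 := (map_ne_zero χ).mpr ((h.offDiagZero z).entry_ne_zero 2)
    rw [h0, h2, ← hD] at hB
    exact mul_left_cancel₀ hne0 (mul_right_cancel₀ hne2 hB)
  intro i
  fin_cases i
  · exact h0
  · exact h1
  · exact h2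

end LinCocycle

/-! ### Periodic data of cohomologous cocycles -/

namespace LinCocycle

section General

variable {κ d : ℕ}

theorem Cohomologous.of_cont {A B : LinCocycle κ d} (h : A.ContCohomologous B) :
    A.Cohomologous B := h.imp fun _ hC => hC.2

theorem Cohomologous.exists_conj {A B : LinCocycle κ d} (h : A.Cohomologous B) :
    ∃ C : LinCocycle κ d, ∀ ω, A ω * C ω = C (shift ω) * B ω :=
  h.imp fun C hC ω => by rw [hC ω, inv_mul_cancel_right]

theorem IsDiagonalFrame.contCohomologous {A C D : LinCocycle κ d} (h : IsDiagonalFrame A C D) :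
    A.ContCohomologous D :=
  ⟨C, h.continuous_frame, fun ω => by rw [← h.conj, mul_inv_cancel_right]⟩

theorem Cohomologous.lyapunovSpectrum_eq {A B : LinCocycle κ d} (h : A.Cohomologous B)
    {p : FullShift κ} (hp : p ∈ Function.periodicPts (shift (κ := κ))) :
    lyapunovSpectrum A p = lyapunovSpectrum B p := by
  obtain ⟨C, hC⟩ := h.exists_conj
  obtain ⟨N, hN, hp⟩ := (mem_periodicPts_iff p).mp hp
  exact lyapunovSpectrum_conj hC (boundedOnOrbit_of_periodic C hN hp)

theorem abs_iter_entry {B : LinCocycle κ d} (hB : ∀ ω, (B ω).IsOffDiagZero) {i : Fin d} {μ : ℝ}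
    (hμ : ∀ ω, |B ω i i| = μ) (n : ℤ) (ω : FullShift κ) : |iter B n ω i i| = μ ^ n := by
  have hnat : ∀ (n : ℕ) (ω : FullShift κ), |iterNat B n ω i i| = μ ^ n := fun n ω => by
    rw [iterNat_entry hB, Finset.abs_prod]
    simp [hμ]
  rcases n with n | n
  · exact (hnat n ω).trans (zpow_natCast μ n).symm
  · simp only [iter]
    rw [(iterNat_offDiagZero hB _ _).inv_entry, abs_inv, hnat, zpow_negSucc]

theorem tendsto_exponent_of_abs_entry_eq {B : LinCocycle κ d} (hB : ∀ ω, (B ω).IsOffDiagZero)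
    {i : Fin d} {μ : ℝ} (hμ : ∀ ω, |B ω i i| = μ) (ω : FullShift κ) {l : Filter ℤ}
    (hl : ∀ᶠ n in l, n ≠ 0) :
    Tendsto (fun n : ℤ => 1 / (n : ℝ) * Real.log |iter B n ω i i|) l (𝓝 (Real.log μ)) := by
  refine tendsto_const_nhds.congr' (hl.mono fun n hn => ?_)
  have hn' : (n : ℝ) ≠ 0 := by exact_mod_cast hn
  change Real.log μ = 1 / (n : ℝ) * Real.log |iter B n ω i i|
  rw [abs_iter_entry hB hμ, Real.log_zpow]
  field_simp

theorem lyapunovSpectrum_of_abs_entry_eq {B : LinCocycle κ d} (hB : ∀ ω, (B ω).IsOffDiagZero)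
    {μ : Fin d → ℝ} (hμ : ∀ ω i, |B ω i i| = μ i) (hpos : ∀ i, 0 < μ i)
    (hinj : Function.Injective μ) (ω : FullShift κ) :
    lyapunovSpectrum B ω = Set.range fun i => Real.log (μ i) :=
  lyapunovSpectrum_of_diagonal hB
    (fun i j hij => hinj (Real.log_injOn_pos (hpos i) (hpos j) hij))
    fun i => tendsto_exponent_of_abs_entry_eq hB (fun ω => hμ ω i) ω (eventually_ne_atTop 0)

theorem IsConstUpToSigns.periodicSpectraAgree {A B : LinCocycle κ d} (hB : B.IsConstUpToSigns)
    (h : A.Cohomologous B) : A.PeriodicSpectraAgree := by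
  obtain ⟨μ, hpos, hinj, hμ⟩ := hB
  have hoff : ∀ ω, (B ω).IsOffDiagZero := fun ω i j hij => by
    have := hμ ω i j
    rwa [Matrix.diagonal_apply_ne _ hij, abs_eq_zero] at this
  have hdiag : ∀ ω i, |B ω i i| = μ i := fun ω i => by
    rw [hμ, Matrix.diagonal_apply_eq]
  intro p hp q hq
  rw [h.lyapunovSpectrum_eq hp, h.lyapunovSpectrum_eq hq,
    lyapunovSpectrum_of_abs_entry_eq hoff hdiag hpos hinj,
    lyapunovSpectrum_of_abs_entry_eq hoff hdiag hpos hinj]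

theorem iterNat_const (B₀ : Matrix.SpecialLinearGroup (Fin d) ℝ) (n : ℕ) (ω : FullShift κ) :
    iterNat (fun _ : FullShift κ => B₀) n ω = B₀ ^ n := by
  induction n with
  | zero => rfl
  | succ n ih => rw [iterNat_succ, ih, pow_succ']

theorem finiteExponent_const (B₀ : Matrix.SpecialLinearGroup (Fin d) ℝ) (ω ω' : FullShift κ) :
    finiteExponent (fun _ : FullShift κ => B₀) ω = finiteExponent (fun _ => B₀) ω' := by
  have : ∀ n : ℤ, iter (fun _ : FullShift κ => B₀) n ω = iter (fun _ => B₀) n ω' := by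
    rintro (n | n) <;> simp only [iter, iterNat_const]
  funext v n
  simp only [finiteExponent, this]

theorem periodicSpectraAgree_of_const {A : LinCocycle κ d}
    {B₀ : Matrix.SpecialLinearGroup (Fin d) ℝ} (h : A.Cohomologous fun _ => B₀) :
    A.PeriodicSpectraAgree := by
  intro p hp q hq
  rw [h.lyapunovSpectrum_eq hp, h.lyapunovSpectrum_eq hq]
  simp only [lyapunovSpectrum, finiteExponent_const B₀ p q]

/-- Otherwise `k` turns around the orbit give `1 ≤ c * (θ ^ N) ^ k` for every `k`. -/
theorem EntryDominates.abs_lt_of_periodic {D : LinCocycle κ d}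
    (hD : ∀ ω, (D ω).IsOffDiagZero) {i j : Fin d} (h : D.EntryDominates i j) {N : ℕ} (hN : 0 < N)
    {p : FullShift κ} (hp : shiftBy N p = p) :
    |iterNat D N p j j| < |iterNat D N p i i| := by
  by_contra! hle
  obtain ⟨c, θ, hc, hθ, hθ1, hcθ⟩ := h
  have hpos : 0 < |iterNat D N p j j| :=
    abs_pos.mpr ((iterNat_offDiagZero hD _ _).entry_ne_zero j)
  have hone : ∀ k : ℕ, 1 ≤ c * (θ ^ N) ^ k := by
    intro k
    have h1 := hcθ (k * N) p
    rw [iterNat_mul_entry_of_periodic hD hp, iterNat_mul_entry_of_periodic hD hp, abs_pow,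
      abs_pow] at h1
    have h2 : |iterNat D N p i i| ^ k ≤ |iterNat D N p j j| ^ k :=
      pow_le_pow_left₀ (abs_nonneg _) hle k
    have h3 := h1.trans (mul_le_mul_of_nonneg_left h2 (by positivity))
    rw [mul_comm k N, pow_mul] at h3
    exact le_of_mul_le_mul_right (by rwa [one_mul]) (pow_pos hpos k)
  have hlim : Tendsto (fun k : ℕ => c * (θ ^ N) ^ k) atTop (𝓝 0) := by
    simpa using (tendsto_pow_atTop_nhds_zero_of_lt_one (by positivity)
      (pow_lt_one₀ hθ.le hθ1 hN.ne')).const_mul c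
  have := ge_of_tendsto' hlim hone
  linarith

/-- A nonzero entry of `P` matches an eigenvalue of `X` with one of `Y`. Distinct moduli force the
indices to coincide, so the signs agree too. -/
theorem eq_of_conj_of_abs_eq {P X Y : Matrix.SpecialLinearGroup (Fin d) ℝ}
    (hX : X.IsOffDiagZero) (hY : Y.IsOffDiagZero) (hP : P * X = Y * P)
    (habs : ∀ i, |X i i| = |Y i i|) (hinj : Function.Injective fun i => |Y i i|) (i : Fin d) :
    X i i = Y i i := by
  obtain ⟨j, hj⟩ := P.exists_col_ne_zero i
  have h := Matrix.SpecialLinearGroup.entry_congr hP j i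
  rw [Matrix.SpecialLinearGroup.mul_entry_of_offDiagZero_right P hX,
    Matrix.SpecialLinearGroup.mul_entry_of_offDiagZero_left hY, mul_comm] at h
  have hXY : X i i = Y j j := mul_right_cancel₀ hj h
  have hij : i = j := hinj (by simp only; rw [← habs, hXY])
  rw [hXY, hij]

end General

/-! ### Spectra at periodic points and generic irregularity -/

section Splitting

variable {κ d : ℕ} {A C D : LinCocycle κ d} (h : IsDiagonalFrame A C D)
  (hdom : ∀ i j : Fin d, i < j → D.EntryDominates i j)

include h

theorem IsDiagonalFrame.continuous_log_entry (i : Fin d) :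
    Continuous fun ω => Real.log |D ω i i| :=
  ((continuous_entry i i).comp h.continuous_diag).abs.log
    fun ω => abs_ne_zero.mpr ((h.offDiagZero ω).entry_ne_zero i)

theorem IsDiagonalFrame.birkhoffMean_log_entry (i : Fin d) (n : ℕ) (ω : FullShift κ) :
    birkhoffMean (fun ω => Real.log |D ω i i|) n ω =
      1 / (n : ℝ) * Real.log |iterNat D n ω i i| := by
  rw [birkhoffMean, log_abs_iterNat_entry h.offDiagZero, one_div]

theorem IsDiagonalFrame.mem_forwardIrregular {i : Fin d} {ω : FullShift κ}
    (hω : ¬ ∃ l, Tendsto (fun n => birkhoffMean (fun ω => Real.log |D ω i i|) n ω) atTop (𝓝 l)) :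
    ω ∈ A.forwardIrregular := by
  refine ⟨slAct (C ω) (EuclideanSpace.single i 1), slAct_ne_zero _ (by simp), ?_⟩
  rintro ⟨l, hl⟩
  rw [tendsto_finiteExponent_conj_iff h.conj (boundedOnOrbit_of_continuous h.continuous_frame ω)
    (by simp) tendsto_one_div_intCast_atTop, tendsto_atTop_int_iff] at hl
  refine hω ⟨l, hl.congr fun n => ?_⟩
  rw [finiteExponent_single h.offDiagZero, h.birkhoffMean_log_entry]
  simp [iter_natCast]

include hdom

theorem IsDiagonalFrame.strictAnti_exponent {N : ℕ} (hN : 0 < N) {p : FullShift κ}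
    (hp : shiftBy N p = p) : StrictAnti fun i => Real.log |iterNat D N p i i| / N := by
  intro i j hij
  have hN' : (0 : ℝ) < N := by exact_mod_cast hN
  have := Real.log_lt_log (h.abs_iterNat_pos N p j)
    ((hdom i j hij).abs_lt_of_periodic h.offDiagZero hN hp)
  exact div_lt_div_of_pos_right this hN'

theorem IsDiagonalFrame.lyapunovSpectrum_of_periodic {N : ℕ} (hN : 0 < N) {p : FullShift κ}
    (hp : shiftBy N p = p) :
    lyapunovSpectrum A p = Set.range fun i => Real.log |iterNat D N p i i| / N := by
  rw [lyapunovSpectrum_conj h.conj (boundedOnOrbit_of_continuous h.continuous_frame p)]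
  refine lyapunovSpectrum_of_diagonal h.offDiagZero
    (h.strictAnti_exponent hdom hN hp).injective fun i => ?_
  rw [tendsto_atTop_int_iff]
  exact tendsto_exponent_of_periodic h.offDiagZero hN hp i

/-- If two periodic points have different spectra then the generic point is forward irregular. -/
theorem IsDiagonalFrame.residual_forwardIrregular (hA : ¬ A.PeriodicSpectraAgree) :
    A.forwardIrregular ∈ residual (FullShift κ) := by
  simp only [PeriodicSpectraAgree, not_forall] at hA
  obtain ⟨p, hp, q, hq, hne⟩ := hA
  obtain ⟨N, hN, hp⟩ := (mem_periodicPts_iff p).mp hp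
  obtain ⟨M, hM, hq⟩ := (mem_periodicPts_iff q).mp hq
  rw [h.lyapunovSpectrum_of_periodic hdom hN hp, h.lyapunovSpectrum_of_periodic hdom hM hq] at hne
  obtain ⟨i, hi⟩ : ∃ i, Real.log |iterNat D N p i i| / N ≠ Real.log |iterNat D M q i i| / M := by
    by_contra! heq
    exact hne (by simp only [heq])
  have hmean : ∀ {N : ℕ}, 0 < N → ∀ {p : FullShift κ}, shiftBy N p = p →
      Tendsto (fun n => birkhoffMean (fun ω => Real.log |D ω i i|) n p) atTop
        (𝓝 (Real.log |iterNat D N p i i| / N)) := fun hN _ hp =>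
    (tendsto_exponent_of_periodic h.offDiagZero hN hp i).congr fun n =>
      (h.birkhoffMean_log_entry i n _).symm
  filter_upwards [residual_not_tendsto_birkhoffMean (h.continuous_log_entry i) (hmean hN hp)
    (hmean hM hq) hi] with ω hω
  exact h.mem_forwardIrregular hω

/-- Domination orders the exponents strictly, so equality of spectra as sets is equality index by
index. -/
theorem IsDiagonalFrame.abs_iterNat_entry_of_periodic (hA : A.PeriodicSpectraAgree)
    {z : FullShift κ} (hz : shift z = z) (N : ℕ) (p : FullShift κ) (i : Fin d)
    (hp : shiftBy N p = p) : |iterNat D N p i i| = |D z i i| ^ N := by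
  rcases Nat.eq_zero_or_pos N with rfl | hN
  · simp [iterNat_zero]
  have hz1 : shiftBy (1 : ℕ) z = z := shiftBy_eq_of_shift_eq hz 1
  have hspec := hA p ((mem_periodicPts_iff p).mpr ⟨N, hN, hp⟩) z
    ((mem_periodicPts_iff z).mpr ⟨1, one_pos, hz1⟩)
  rw [h.lyapunovSpectrum_of_periodic hdom hN hp, h.lyapunovSpectrum_of_periodic hdom one_pos hz1,
    StrictAnti.range_inj (h.strictAnti_exponent hdom hN hp)
      (h.strictAnti_exponent hdom one_pos hz1)] at hspec
  have hi := congrFun hspec i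
  simp only [iterNat_one, Nat.cast_one, div_one] at hi
  have hN' : (N : ℝ) ≠ 0 := by exact_mod_cast hN.ne'
  rw [div_eq_iff hN', mul_comm, ← Real.log_pow] at hi
  exact Real.log_injOn_pos (h.abs_iterNat_pos N p i)
    (pow_pos (abs_pos.mpr ((h.offDiagZero z).entry_ne_zero i)) N) hi

theorem IsDiagonalFrame.strictAnti_abs_entry {z : FullShift κ} (hz : shift z = z) :
    StrictAnti fun i => |D z i i| := fun i j hij => by
  have := (hdom i j hij).abs_lt_of_periodic h.offDiagZero one_pos (shiftBy_eq_of_shift_eq hz 1)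
  simpa only [iterNat_one] using this

/-- The diagonal matrices at `p` and `z` are both conjugate to `B₀ ^ N`. Equal spectra give the
moduli, and conjugacy gives the signs. -/
theorem IsDiagonalFrame.iterNat_entry_of_const
    {B₀ : Matrix.SpecialLinearGroup (Fin d) ℝ} (hB : A.Cohomologous fun _ => B₀)
    {z : FullShift κ} (hz : shift z = z) (N : ℕ) (p : FullShift κ) (i : Fin d)
    (hp : shiftBy N p = p) : iterNat D N p i i = D z i i ^ N := by
  have habs := h.abs_iterNat_entry_of_periodic hdom (periodicSpectraAgree_of_const hB) hz
  rcases Nat.eq_zero_or_pos N with rfl | hN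
  · simp [iterNat_zero]
  obtain ⟨H, hH⟩ := hB.exists_conj
  have hz' := shiftBy_eq_of_shift_eq hz N
  have key : ∀ {p}, shiftBy N p = p →
      iterNat D N p = (C p)⁻¹ * H p * B₀ ^ N * (H p)⁻¹ * C p := by
    intro p hp
    have h1 := iterNat_conj h.conj N p
    have h2 := iterNat_conj hH N p
    rw [hp, iterNat_const] at h2
    rw [hp, eq_mul_inv_of_mul_eq h2] at h1
    rw [eq_inv_mul_of_mul_eq h1.symm]
    group
  rw [← iterNat_entry_of_shift_eq h.offDiagZero hz]
  refine eq_of_conj_of_abs_eq (P := (C z)⁻¹ * H z * (H p)⁻¹ * C p)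
    (iterNat_offDiagZero h.offDiagZero N p) (iterNat_offDiagZero h.offDiagZero N z) ?_ ?_ ?_ i
  · rw [key hp, key hz']
    group
  · intro j
    rw [habs N p j hp, habs N z j hz']
  · intro j k hjk
    by_contra hne
    rcases lt_or_gt_of_ne hne with hlt | hlt
    · exact ((hdom _ _ hlt).abs_lt_of_periodic h.offDiagZero hN hz').ne' hjk
    · exact ((hdom _ _ hlt).abs_lt_of_periodic h.offDiagZero hN hz').ne hjk

end Splitting

/-! ### Typicality and orientation in dimension three -/

section Three

variable {κ : ℕ} {A C D : LinCocycle κ 3}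
  {E : Fin 3 → FullShift κ → Submodule ℝ (EuclideanSpace ℝ (Fin 3))}

theorem IsDiagonalFrame.isLyapunovTypical (h : IsDiagonalFrame A C D)
    (hsplit : ∀ ω, DirectSum.IsInternal fun i => E i ω)
    (hrank : ∀ i ω, Module.finrank ℝ (E i ω) = 1)
    (hCE : ∀ ω i, slAct (C ω) (EuclideanSpace.single i 1) ∈ E i ω) {μ : Fin 3 → ℝ}
    (hμ : ∀ ω i, |D ω i i| = μ i) (hanti : StrictAnti μ) (ω : FullShift κ) :
    A.IsLyapunovTypical ω := by
  have hpos : ∀ i, 0 < μ i := fun i => by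
    rw [← hμ ω i]
    exact abs_pos.mpr ((h.offDiagZero ω).entry_ne_zero i)
  refine ⟨3, fun i => E i ω, fun i => Real.log (μ i), hsplit ω, fun i hbot => ?_,
    fun i j hij => Real.log_lt_log (hpos j) (hanti hij), fun i v hv hv0 => ?_⟩
  · have := hrank i ω
    rw [show E i ω = ⊥ from hbot, finrank_bot] at this
    exact zero_ne_one this
  · obtain ⟨t, rfl⟩ := exists_smul_eq_of_mem_line (hrank i ω) (hCE ω i)
      (slAct_ne_zero _ (by simp)) hv
    have ht : t ≠ 0 := fun h0 => hv0 (by rw [h0, zero_smul])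
    have key : ∀ {l : Filter ℤ}, Tendsto (fun n : ℤ => 1 / (n : ℝ)) l (𝓝 0) →
        (∀ᶠ n in l, n ≠ 0) → Tendsto (finiteExponent A ω
          (t • slAct (C ω) (EuclideanSpace.single i 1))) l (𝓝 (Real.log (μ i))) := by
      intro l hl hl0
      rw [← map_smul, tendsto_finiteExponent_conj_iff h.conj
        (boundedOnOrbit_of_continuous h.continuous_frame ω) (smul_ne_zero ht (by simp)) hl]
      have := (hl.mul_const (Real.log ‖t‖)).add
        (tendsto_exponent_of_abs_entry_eq h.offDiagZero (fun ω => hμ ω i) ω hl0)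
      rw [zero_mul, zero_add] at this
      refine this.congr fun n => ?_
      rw [finiteExponent_smul _ _ ht (by simp), finiteExponent_single h.offDiagZero]
    exact ⟨key tendsto_one_div_intCast_atTop (eventually_ne_atTop 0),
      key tendsto_one_div_intCast_atBot (eventually_ne_atBot 0)⟩

theorem IsDiagonalFrame.isConstUpToSigns {κ d : ℕ} {A C D : LinCocycle κ d}
    (h : IsDiagonalFrame A C D) {μ : Fin d → ℝ} (hμ : ∀ ω i, |D ω i i| = μ i)
    (hpos : ∀ i, 0 < μ i) (hinj : Function.Injective μ) : D.IsConstUpToSigns := by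
  refine ⟨μ, hpos, hinj, fun ω i j => ?_⟩
  by_cases hij : i = j
  · subst hij
    rw [hμ, Matrix.diagonal_apply_eq]
  · rw [h.offDiagZero ω i j hij, Matrix.diagonal_apply_ne _ hij, abs_zero]

theorem hasSimpleSpectrum_const {κ d : ℕ} {B₀ : Matrix.SpecialLinearGroup (Fin d) ℝ}
    (hoff : B₀.IsOffDiagZero) (hinj : Function.Injective fun i => |B₀ i i|) :
    HasSimpleSpectrum fun _ : FullShift κ => B₀ := by
  have hpos : ∀ i, 0 < |B₀ i i| := fun i => abs_pos.mpr (hoff.entry_ne_zero i)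
  intro ω
  rw [lyapunovSpectrum_of_abs_entry_eq (fun _ => hoff) (fun _ _ => rfl) hpos hinj,
    Set.ncard_range_of_injective
      fun i j hij => hinj (Real.log_injOn_pos (hpos i) (hpos j) hij), Nat.card_fin]

theorem IsDiagonalFrame.exists_rescaled_frame_in (h : IsDiagonalFrame A C D) (hA : A.IsLocConst)
    (hdom : ∀ i j : Fin 3, i < j → D.EntryDominates i j)
    (hCE : ∀ ω i, slAct (C ω) (EuclideanSpace.single i 1) ∈ E i ω) {z : FullShift κ}
    (hz : shift z = z) {χ : ℝ →*₀ ℝ} (hχ : Continuous χ)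
    (hper : ∀ (N : ℕ) (p : FullShift κ) (i : Fin 3), shiftBy N p = p →
      χ (iterNat D N p i i) = χ (D z i i) ^ N) :
    ∃ C' B : LinCocycle κ 3, IsDiagonalFrame A C' B ∧
      (∀ ω i, slAct (C' ω) (EuclideanSpace.single i 1) ∈ E i ω) ∧
      ∀ ω i, χ (B ω i i) = χ (D z i i) := by
  obtain ⟨S, hS, B, hB, hBχ⟩ := h.exists_rescaled_frame hA hdom hz hχ hper
  refine ⟨_, B, hB, fun ω i => ?_, hBχ⟩
  rw [slAct_mul, (hS ω).slAct_single, map_smul]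
  exact (E i ω).smul_mem _ (hCE ω i)

/-- The multiplier of a line bundle with constant orientation over a periodic orbit is a positive
multiple of a power of the orientation sign. -/
theorem IsDiagonalFrame.exists_iterNat_entry_of_orientation {κ d : ℕ} {A C D : LinCocycle κ d}
    (h : IsDiagonalFrame A C D) {F : FullShift κ → Submodule ℝ (EuclideanSpace ℝ (Fin d))}
    (hrank : ∀ ω, Module.finrank ℝ (F ω) = 1) {i : Fin d}
    (hCF : ∀ ω, slAct (C ω) (EuclideanSpace.single i 1) ∈ F ω)
    {v : FullShift κ → EuclideanSpace ℝ (Fin d)} (hv : ∀ ω, v ω ∈ F ω ∧ v ω ≠ 0) {s : ℝ}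
    (hs : ∀ ω, ∃ a : ℝ, 0 < a ∧ slAct (A ω) (v ω) = (s * a) • v (shift ω)) {N : ℕ}
    {p : FullShift κ} (hp : shiftBy N p = p) :
    ∃ a : ℝ, 0 < a ∧ iterNat D N p i i = s ^ N * a := by
  have hiter : ∀ n : ℕ, ∃ a : ℝ, 0 < a ∧
      slAct (iterNat A n p) (v p) = (s ^ n * a) • v (shiftBy n p) := by
    intro n
    induction n with
    | zero => exact ⟨1, one_pos, by simp [iterNat_zero, slAct_one]⟩
    | succ n ih =>
      obtain ⟨a, ha, h1⟩ := ih
      obtain ⟨a', ha', h2⟩ := hs (shiftBy n p)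
      refine ⟨a * a', mul_pos ha ha', ?_⟩
      rw [iterNat_succ, slAct_mul, h1, map_smul, h2, smul_smul, shift_shiftBy]
      push_cast
      congr 1
      ring
  obtain ⟨a, ha, h1⟩ := hiter N
  refine ⟨a, ha, ?_⟩
  obtain ⟨t, ht⟩ := exists_smul_eq_of_mem_line (hrank p) (hv p).1 (hv p).2 (hCF p)
  have hne : slAct (C p) (EuclideanSpace.single i (1 : ℝ)) ≠ 0 := slAct_ne_zero _ (by simp)
  have h2 := h.slAct_iterNat_single N p i
  rw [hp, ht, map_smul, h1, hp, smul_comm, ← ht] at h2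
  exact (smul_left_injective ℝ hne h2).symm

/-- The orientation character makes the sign over a period equal to that of the `N`-th power at `z`;
equal periodic spectra give the modulus. -/
theorem IsDiagonalFrame.iterNat_entry_of_orientation (h : IsDiagonalFrame A C D)
    (hdom : ∀ i j : Fin 3, i < j → D.EntryDominates i j)
    (hrank : ∀ i ω, Module.finrank ℝ (E i ω) = 1)
    (hCE : ∀ ω i, slAct (C ω) (EuclideanSpace.single i 1) ∈ E i ω)
    (hA : A.PeriodicSpectraAgree) (hor : A.HasConstantOrientation E)
    {z : FullShift κ} (hz : shift z = z) (N : ℕ) (p : FullShift κ) (i : Fin 3)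
    (hp : shiftBy N p = p) : iterNat D N p i i = D z i i ^ N := by
  obtain ⟨v, s, -, hv, hs, hvs⟩ := hor i
  obtain ⟨a, ha, h1⟩ := h.exists_iterNat_entry_of_orientation (hrank i) (fun ω => hCE ω i) hv hvs hp
  obtain ⟨b, hb, h2⟩ := h.exists_iterNat_entry_of_orientation (hrank i) (fun ω => hCE ω i) hv hvs
    (N := 1) (shiftBy_eq_of_shift_eq hz 1)
  rw [iterNat_one, pow_one] at h2
  have habs := h.abs_iterNat_entry_of_periodic hdom hA hz N p i hp
  have hs1 : |s| = 1 := by rcases hs with rfl | rfl <;> simp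
  rw [h1, h2, abs_mul, abs_mul, abs_pow, hs1, one_pow, one_mul, one_mul, abs_of_pos ha,
    abs_of_pos hb] at habs
  rw [h1, h2, habs, mul_pow]

theorem IsDiagonalFrame.hasConstantOrientation (h : IsDiagonalFrame A C D)
    (hCE : ∀ ω i, slAct (C ω) (EuclideanSpace.single i 1) ∈ E i ω) {z : FullShift κ}
    (hconst : ∀ ω i, D ω i i = D z i i) : A.HasConstantOrientation E := by
  intro i
  have hne : D z i i ≠ 0 := (h.offDiagZero z).entry_ne_zero i
  have hcont : Continuous fun ω => slAct (C ω) (EuclideanSpace.single i (1 : ℝ)) := by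
    refine (PiLp.continuous_toLp 2 _).comp (f := fun ω j => C ω j i)
      (continuous_pi fun j => (continuous_entry j i).comp h.continuous_frame) |>.congr fun ω => ?_
    ext j
    rw [_root_.slAct_single]
    rfl
  obtain ⟨s, a, hs, ha, hsa⟩ : ∃ s a : ℝ, (s = 1 ∨ s = -1) ∧ 0 < a ∧ D z i i = s * a := by
    rcases lt_or_gt_of_ne hne with hlt | hlt
    · exact ⟨-1, -D z i i, Or.inr rfl, neg_pos.mpr hlt, by ring⟩
    · exact ⟨1, D z i i, Or.inl rfl, hlt, by ring⟩
  refine ⟨_, s, hcont, fun ω => ⟨hCE ω i, slAct_ne_zero _ (by simp)⟩, hs, fun ω => ⟨a, ha, ?_⟩⟩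
  rw [h.slAct_single, hconst, hsa]

theorem IsFinestDominatedSplitting.entryDominates (hE : A.IsFinestDominatedSplitting E)
    (h : IsDiagonalFrame A C D)
    (hCE : ∀ ω i, slAct (C ω) (EuclideanSpace.single i 1) ∈ E i ω) (i j : Fin 3) (hij : i < j) :
    D.EntryDominates i j := by
  have h01 : D.EntryDominates 0 1 := h.entryDominates hCE (hE.dominated 0 1 rfl)
  have h12 : D.EntryDominates 1 2 := h.entryDominates hCE (hE.dominated 1 2 rfl)
  fin_cases i <;> fin_cases j <;> first | exact absurd hij (by decide) | skip
  · exact h01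
  · exact h01.trans h12
  · exact h12

end Three

end LinCocycle

/-! ### The main theorem -/

theorem mainTheorem8 (κ : ℕ) (hκ : 1 ≤ κ) (A : LinCocycle κ 3) (hA : A.IsLocConst)
    (E : Fin 3 → FullShift κ → Submodule ℝ (EuclideanSpace ℝ (Fin 3)))
    (hE : A.IsFinestDominatedSplitting E) :
    List.TFAE [
      A.nonTypical = ∅,
      A.forwardIrregular = ∅,
      A.PeriodicSpectraAgree,
      ∃ B : LinCocycle κ 3, B.IsConstUpToSigns ∧ A.ContCohomologous B,
      ∃ B : LinCocycle κ 3, B.IsConstUpToSigns ∧ A.Cohomologous B] ∧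
    List.TFAE [
      A.HasConstantOrientation E ∧ A.nonTypical = ∅,
      ∃ B₀ : Matrix.SpecialLinearGroup (Fin 3) ℝ,
        LinCocycle.HasSimpleSpectrum (fun _ : FullShift κ => B₀) ∧
        A.ContCohomologous (fun _ => B₀),
      ∃ B₀ : Matrix.SpecialLinearGroup (Fin 3) ℝ,
        LinCocycle.HasSimpleSpectrum (fun _ : FullShift κ => B₀) ∧
        A.Cohomologous (fun _ => B₀)] ∧
    (A.nonTypical.Nonempty →
      A.forwardIrregular ∈ residual (FullShift κ) ∧ A.nonTypical ∈ residual (FullShift κ)) := by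
  obtain ⟨C, D, h, hCE⟩ := LinCocycle.exists_diagonalFrame hA hE
  have hdom := hE.entryDominates h hCE
  -- A constant sequence is the reference fixed point for all periodic data.
  let z : FullShift κ := fun _ => ⟨0, hκ⟩
  have hz : shift z = z := rfl
  have hanti := h.strictAnti_abs_entry hdom hz
  have hpos : ∀ i, 0 < |D z i i| := fun i => abs_pos.mpr ((h.offDiagZero z).entry_ne_zero i)
  have hframe : A.PeriodicSpectraAgree → ∃ C' B : LinCocycle κ 3,
      LinCocycle.IsDiagonalFrame A C' B ∧
      (∀ ω i, slAct (C' ω) (EuclideanSpace.single i 1) ∈ E i ω) ∧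
      ∀ ω i, |B ω i i| = |D z i i| := fun hper =>
    h.exists_rescaled_frame_in (χ := absHom) hA hdom hCE hz continuous_abs
      (h.abs_iterNat_entry_of_periodic hdom hper hz)
  have hsigned : (∀ (N : ℕ) (p : FullShift κ) (i : Fin 3), shiftBy N p = p →
      D.iterNat N p i i = D z i i ^ N) → ∃ C' : LinCocycle κ 3,
      LinCocycle.IsDiagonalFrame A C' (fun _ => D z) ∧
      ∀ ω i, slAct (C' ω) (EuclideanSpace.single i 1) ∈ E i ω := by
    -- With the identity as `χ`, the rescaled diagonal form is genuinely constant.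
    intro hper
    obtain ⟨C', B, hB, hC'E, hBD⟩ := h.exists_rescaled_frame_in
      (χ := MonoidWithZeroHom.id ℝ) hA hdom hCE hz continuous_id hper
    have : B = fun _ => D z := by
      funext ω
      ext i j
      by_cases hij : i = j
      · subst hij; exact hBD ω i
      · rw [hB.offDiagZero ω i j hij, h.offDiagZero z i j hij]
    exact ⟨C', this ▸ hB, hC'E⟩
  have hnonempty : A.nonTypical = ∅ → A.forwardIrregular = ∅ := fun h0 =>
    Set.subset_empty_iff.mp (h0 ▸ A.forwardIrregular_subset_nonTypical)
  have hirr : A.forwardIrregular = ∅ → A.PeriodicSpectraAgree := by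
    intro h0
    by_contra hnot
    have : Nonempty (FullShift κ) := ⟨z⟩
    -- By the Baire property of the compact shift space, a residual set is dense, hence nonempty.
    have hres := (dense_of_mem_residual (h.residual_forwardIrregular hdom hnot)).nonempty
    rw [h0] at hres
    exact Set.not_nonempty_empty hres
  have htyp : A.PeriodicSpectraAgree → A.nonTypical = ∅ := by
    intro hper
    obtain ⟨C', B, hB, hC'E, hBμ⟩ := hframe hper
    exact Set.eq_empty_of_forall_notMem fun ω hω =>
      hω (hB.isLyapunovTypical hE.splits hE.one_dim hC'E hBμ hanti ω)
  refine ⟨?_, ?_, ?_⟩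
  · tfae_have 1 → 2 := hnonempty
    tfae_have 2 → 3 := hirr
    tfae_have 3 → 1 := htyp
    tfae_have 3 → 4 := fun hper => by
      obtain ⟨C', B, hB, -, hBμ⟩ := hframe hper
      exact ⟨B, hB.isConstUpToSigns hBμ hpos hanti.injective, hB.contCohomologous⟩
    tfae_have 4 → 5 := fun ⟨B, hB, hAB⟩ => ⟨B, hB, .of_cont hAB⟩
    tfae_have 5 → 3 := fun ⟨B, hB, hAB⟩ => hB.periodicSpectraAgree hAB
    tfae_finish
  · tfae_have 1 → 2 := fun ⟨hor, h0⟩ => by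
      obtain ⟨C', hC', -⟩ := hsigned (h.iterNat_entry_of_orientation hdom hE.one_dim hCE
        (hirr (hnonempty h0)) hor hz)
      exact ⟨D z, LinCocycle.hasSimpleSpectrum_const (h.offDiagZero z) hanti.injective,
        hC'.contCohomologous⟩
    tfae_have 2 → 3 := fun ⟨B₀, hB, hAB⟩ => ⟨B₀, hB, .of_cont hAB⟩
    tfae_have 3 → 1 := fun ⟨B₀, _, hAB⟩ => by
      obtain ⟨C', hC', hC'E⟩ := hsigned (h.iterNat_entry_of_const hdom hAB hz)
      exact ⟨hC'.hasConstantOrientation hC'E (z := z) fun _ _ => rfl,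
        htyp (LinCocycle.periodicSpectraAgree_of_const hAB)⟩
    tfae_finish
  · intro hne
    have hres := h.residual_forwardIrregular hdom fun hper => hne.ne_empty (htyp hper)
    exact ⟨hres, mem_of_superset hres A.forwardIrregular_subset_nonTypical⟩
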